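/- Setting. Let $\Phi$ be the standard normal distribution function. Fix $d$. For every sample size $n$ let $p=p_n$, let $B\in\mathbb R^{p\times d}$, $\tau_1,\dots,\tau_p$ and $c_1,\dots,c_p\in\mathbb R$ (all depending on $n$), and suppose that $e_i=BZ_i+\varepsilon_i$, $i=1,\dots,n$, are independent $p$-dimensional normal random vectors with mean zero and $\mathrm{var}(e_{ij})=1$, where $Z_i\in\mathbb R^d$ and $\varepsilon_i\in\mathbb R^p$ are uncorrelated with each other, $\mathrm{cov}(Z_i)=I_d$, $E(\varepsilon_i)=0$ and $\mathrm{cov}(\varepsilon_i)=\mathrm{diag}(\tau_1^2,\dots,\tau_p^2)$. One observes $Y_{ij}=I(e_{ij}>c_j)$. Write $P_j=P(Y_{ij}=1)$ and $P_{jk}=P(Y_{ij}=Y_{ik}=1)$. For $|s|<1$ let $$\ell(c,c';s)=\frac1{2\pi\sqrt{1-s^2}}\int_c^\infty\!\int_{c'}^\infty\exp\Big\{-\frac{x^2+y^2-2sxy}{2(1-s^2)}\Big\}\,dy\,dx .$$ Estimators. Let $\widehat P_j=n^{-1}\sum_{i=1}^n I(Y_{ij}=1)$, $\widehat P_{jk}=n^{-1}\sum_{i=1}^n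 I(Y_{ij}=Y_{ik}=1)$ and $\widehat c_j=-\Phi^{-1}(\widehat P_j)$. Let $\widehat\Sigma=(\widehat\sigma_{jk})\in\mathbb R^{p\times p}$ with $\widehat\sigma_{jj}=1$ and, for $j\ne k$, $\widehat\sigma_{jk}\in(-1,1)$ the solution of $\ell(\widehat c_j,\widehat c_k;\widehat\sigma_{jk})=\widehat P_{jk}$ (where $\Phi^{-1}(\widehat P_j)$ or the solution does not exist, a fixed real value is used instead). For $p\ge d$ let $\widehat\Sigma_d\in\mathbb R^{p\times d}$ be any matrix whose columns are orthonormal eigenvectors of $\widehat\Sigma$ associated with its $d$ largest eigenvalues, in decreasing order and counted with multiplicity, let $Q_{\widehat\Sigma_d}=I_p-\widehat\Sigma_d\widehat\Sigma_d^\top$, and let $\widehat\tau_j^2$ be the $j$-th diagonal entry of $Q_{\widehat\Sigma_d}\widehat\Sigma Q_{\widehat\Sigma_d}^\top$. Theorem. Assume that $p_n\to\infty$ as $n\to\infty$ and that there are constants, not depending on $n$, such that (C1) $0<P^{(1)}_{\min}\le P_j\le P^{(1)}_{\max}<1$ for all $1\le j\le p$; (C2) $0<P^{(2)}_{\min}\le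 P_{jk}\le P^{(2)}_{\max}<1$ for all $1\le j,k\le p$; (C3) $0<\tau_{\min}\le\tau_j\le\tau_{\max}<1$ for all $1\le j\le p$; (C4) $p_n\le\rho n^{\xi}$ for all $n\ge1$, with $\rho>0$ and $0<\xi<1/2$. Then $p^{-1}\sum_{j=1}^p|\widehat\tau_j^2-\tau_j^2|\to0$ in probability as $n\to\infty$. -/

import Mathlib

open MeasureTheory ProbabilityTheory Filter Topology Matrix

/-- `Φ`, the cumulative distribution function of the standard normal law. -/
noncomputable def stdNormalCDF (x : ℝ) : ℝ := cdf (gaussianReal 0 1) x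

/-- `Φ⁻¹`; it is the inverse of `Φ` on `(0, 1)`, the range of `Φ`, and takes one fixed
(unspecified) real value elsewhere. -/
noncomputable def probit (u : ℝ) : ℝ := Function.invFun stdNormalCDF u

/-- `ℓ(c₁, c₂; s)`, for `|s| < 1` the upper orthant probability `P(X > c₁, Y > c₂)` of the centred
bivariate normal law with unit variances and correlation `s`. -/
noncomputable def bivTail (c₁ c₂ s : ℝ) : ℝ :=
  (2 * Real.pi * √(1 - s ^ 2))⁻¹ *
    ∫ z in Set.Ioi c₁ ×ˢ Set.Ioi c₂,
      Real.exp (-((z.1 ^ 2 + z.2 ^ 2 - 2 * s * z.1 * z.2) / (2 * (1 - s ^ 2))))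

/-- `ℓ⁻¹(c₁, c₂; P)`, the solution `s ∈ (-1, 1)` of `ℓ(c₁, c₂; s) = P`; where there is none it takes
one fixed (unspecified) real value. -/
noncomputable def bivTailInv (c₁ c₂ P : ℝ) : ℝ :=
  Function.invFunOn (bivTail c₁ c₂) (Set.Ioo (-1) 1) P

section Model

variable {Ω : Type*} {p d n : ℕ}

/-- The latent continuous vector `e = B Z + ε`. -/
def latent (B : Matrix (Fin p) (Fin d) ℝ) (Z : Ω → Fin d → ℝ) (ε : Ω → Fin p → ℝ)
    (ω : Ω) : Fin p → ℝ := B *ᵥ Z ω + ε ω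

open Classical in
/-- The binary vector with coordinates `Y_j = I(e_j > c_j)`. -/
noncomputable def binaryObs (c : Fin p → ℝ) (e : Ω → Fin p → ℝ) (ω : Ω) (j : Fin p) : ℕ :=
  if e ω j > c j then 1 else 0

/-- The probit factor model for a sample of `n` observations of dimension `p` with `d` factors:
`e_i = B Z_i + ε_i` is multivariate normal with mean zero and unit variances, the `e_i` are
independent, `cov(Z_i) = I_d`, `E(ε_i) = 0`, `cov(ε_i) = diag(τ_1², …, τ_p²)`, and `Z_i` and `ε_i`
are uncorrelated. -/
structure IsProbitFactorModel [MeasurableSpace Ω] (μ : Measure Ω)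
    (B : Matrix (Fin p) (Fin d) ℝ) (τ : Fin p → ℝ)
    (Z : Fin n → Ω → Fin d → ℝ) (ε : Fin n → Ω → Fin p → ℝ) : Prop where
  measurable_factor : ∀ i, Measurable (Z i)
  measurable_noise : ∀ i, Measurable (ε i)
  memLp_factor : ∀ i k, MemLp (fun ω => Z i ω k) 2 μ
  memLp_noise : ∀ i j, MemLp (fun ω => ε i ω j) 2 μ
  cov_factor : ∀ i k l, cov[fun ω => Z i ω k, fun ω => Z i ω l; μ] = if k = l then 1 else 0
  mean_noise : ∀ i j, ∫ ω, ε i ω j ∂μ = 0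
  cov_noise : ∀ i j l,
    cov[fun ω => ε i ω j, fun ω => ε i ω l; μ] = if j = l then τ j ^ 2 else 0
  cov_factor_noise : ∀ i k j, cov[fun ω => Z i ω k, fun ω => ε i ω j; μ] = 0
  gaussian : ∀ i, HasGaussianLaw (latent B (Z i) (ε i)) μ
  mean_latent : ∀ i j, ∫ ω, latent B (Z i) (ε i) ω j ∂μ = 0
  variance_latent : ∀ i j, Var[fun ω => latent B (Z i) (ε i) ω j; μ] = 1
  indep : iIndepFun (fun i => latent B (Z i) (ε i)) μ

/-- `P̂_j`, the fraction of observations with `Y_ij = 1`. -/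
noncomputable def hatP (Y : Fin n → Fin p → ℕ) (j : Fin p) : ℝ :=
  (∑ i, if Y i j = 1 then (1 : ℝ) else 0) / n

/-- `P̂_{jk}`, the fraction of observations with `Y_ij = Y_ik = 1`. -/
noncomputable def hatP₂ (Y : Fin n → Fin p → ℕ) (j k : Fin p) : ℝ :=
  (∑ i, if Y i j = 1 ∧ Y i k = 1 then (1 : ℝ) else 0) / n

/-- `ĉ_j = -Φ⁻¹(P̂_j)`. -/
noncomputable def hatC (Y : Fin n → Fin p → ℕ) (j : Fin p) : ℝ := -probit (hatP Y j)

/-- The moment estimator `Σ̂` of `cov(e_i)`, with unit diagonal and off-diagonal entries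
`σ̂_{jk} = ℓ⁻¹(ĉ_j, ĉ_k; P̂_{jk})`. -/
noncomputable def hatSigma (Y : Fin n → Fin p → ℕ) : Matrix (Fin p) (Fin p) ℝ :=
  Matrix.of fun j k => if j = k then 1 else bivTailInv (hatC Y j) (hatC Y k) (hatP₂ Y j k)

/-- The columns of `V` are orthonormal eigenvectors of `A` for its `d` largest eigenvalues, in
decreasing order: they are the first `d` vectors of an orthonormal eigenbasis of `A` (the columns
of `U`) ordered by decreasing eigenvalue. -/
def IsLeadingEigenvectors (A : Matrix (Fin p) (Fin p) ℝ) (V : Matrix (Fin p) (Fin d) ℝ) : Prop :=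
  ∃ (h : d ≤ p) (U : Matrix (Fin p) (Fin p) ℝ) (lam : Fin p → ℝ),
    Uᵀ * U = 1 ∧ Antitone lam ∧ A * U = U * Matrix.diagonal lam ∧
      V = U.submatrix id (Fin.castLE h)

/-- `τ̂_j²`, the `j`-th diagonal entry of `Q A Qᵀ` with `Q = I - V Vᵀ`. -/
def hatTauSq (A : Matrix (Fin p) (Fin p) ℝ) (V : Matrix (Fin p) (Fin d) ℝ) (j : Fin p) : ℝ :=
  ((1 - V * Vᵀ) * A * (1 - V * Vᵀ)ᵀ : Matrix (Fin p) (Fin p) ℝ) j j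

end Model

/-! The proof separates a deterministic perturbation bound from a mean-square estimate of `Σ̂`.
Write `Σ̂ = B Bᵀ + D + E` with `D = diag(τ²)`, and let `P` be the projection onto the leading
eigenvectors and `Q = 1 - P`. Then `Q Σ̂ Q` splits into three parts whose diagonals are controlled
in `ℓ¹`. `Q D Q` differs from `D` by `O(d)`, because `P` has trace `d`. `Q E Q` costs `O(d ‖E‖)` in
Frobenius norm, because `E` has zero diagonal. `Q B Bᵀ Q` is positive semidefinite and its trace is
small by Ky Fan's principle. No eigenvalue gap and no convergence of eigenvectors enters. The
outcome, `sum_abs_hatTauSq_sub_le`, is `4d + 5d ‖E‖`, so after division by `p` it remains to show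
that `‖E‖ / p → 0` in probability.

For this, `bivTail` is strictly increasing and continuous in the correlation, so the estimator
`corrEst` is continuous at every true triple of probabilities. By compactness it is uniformly so
when thresholds are bounded (C1) and correlations stay away from `±1` (C3). As `corrEst` is bounded,
its squared error is at most `η²` plus a constant times the squared error of three empirical
frequencies. Each of these has mean at most `1/n`, and averaging over all pairs and applying
Markov's inequality finishes the proof. -/

/-! ### The standard normal distribution function and its inverse -/

theorem stdNormalCDF_eq_real (x : ℝ) : stdNormalCDF x = (gaussianReal 0 1).real (Set.Iic x) :=
  cdf_eq_real _ x

theorem stdNormalCDF_nonneg (x : ℝ) : 0 ≤ stdNormalCDF x := cdf_nonneg _ x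

theorem stdNormalCDF_le_one (x : ℝ) : stdNormalCDF x ≤ 1 := cdf_le_one _ x

instance instNullSingletonClassStdGaussian : NullSingletonClass (gaussianReal 0 1) :=
  nullSingletonClass_gaussianReal one_ne_zero

theorem gaussianReal_pos_of_isOpen {U : Set ℝ} (hU : IsOpen U) (hne : U.Nonempty) :
    0 < gaussianReal 0 1 U := by
  rw [pos_iff_ne_zero]
  intro h
  exact (hU.measure_pos volume hne).ne' (gaussianReal_absolutelyContinuous' 0 one_ne_zero h)

theorem strictMono_stdNormalCDF : StrictMono stdNormalCDF := by
  intro x y hxy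
  have h1 : (gaussianReal 0 1).real (Set.Iic y)
      = (gaussianReal 0 1).real (Set.Iic x) + (gaussianReal 0 1).real (Set.Ioc x y) := by
    rw [← measureReal_union _ measurableSet_Ioc, Set.Iic_union_Ioc_eq_Iic hxy.le]
    exact (Set.disjoint_left.2 fun z hz hz' => not_lt.2 hz hz'.1)
  have h2 : 0 < (gaussianReal 0 1).real (Set.Ioc x y) := by
    refine ENNReal.toReal_pos (ne_of_gt ?_) (measure_ne_top _ _)
    exact (gaussianReal_pos_of_isOpen isOpen_Ioo (Set.nonempty_Ioo.2 hxy)).trans_le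
      (measure_mono Set.Ioo_subset_Ioc_self)
  rw [stdNormalCDF_eq_real, stdNormalCDF_eq_real]
  linarith

theorem continuous_stdNormalCDF : Continuous stdNormalCDF := by
  have h : stdNormalCDF = fun x => ∫ w, (Set.Iic x).indicator (fun _ => (1 : ℝ)) w
      ∂(gaussianReal 0 1) := by
    ext x
    rw [stdNormalCDF_eq_real, integral_indicator_const _ measurableSet_Iic]; simp
  rw [h, continuous_iff_continuousAt]
  intro x
  refine continuousAt_of_dominated (bound := fun _ => 1) (Eventually.of_forall fun y => ?_)
    (Eventually.of_forall fun y => Eventually.of_forall fun w => ?_) (integrable_const _) ?_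
  · exact ((measurable_const).indicator measurableSet_Iic).aestronglyMeasurable
  · by_cases hw : w ∈ Set.Iic y <;> simp [hw]
  · have : ∀ᵐ w ∂(gaussianReal 0 1), w ≠ x := by
      simp [ae_iff]
    filter_upwards [this] with w hw
    rcases lt_or_gt_of_ne hw with h | h
    · have : (fun y => (Set.Iic y).indicator (fun _ => (1 : ℝ)) w) =ᶠ[𝓝 x] fun _ => 1 := by
        filter_upwards [lt_mem_nhds h] with y hy
        simp [hy.le]
      exact continuousAt_const.congr this.symm
    · have : (fun y => (Set.Iic y).indicator (fun _ => (1 : ℝ)) w) =ᶠ[𝓝 x] fun _ => 0 := by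
        filter_upwards [gt_mem_nhds h] with y hy
        simp [hy]
      exact continuousAt_const.congr this.symm

theorem probit_stdNormalCDF (x : ℝ) : probit (stdNormalCDF x) = x :=
  Function.leftInverse_invFun strictMono_stdNormalCDF.injective x

/-- `probit` is a true inverse only on the range of `Φ`. The intermediate value theorem shows that
this range contains a neighbourhood of `Φ(x)`, and strict monotonicity locates the preimages. -/
theorem continuousAt_probit (x : ℝ) : ContinuousAt probit (stdNormalCDF x) := by
  rw [ContinuousAt, probit_stdNormalCDF, tendsto_order]
  have key : ∀ a b, a < x → x < b → ∀ᶠ u in 𝓝 (stdNormalCDF x), a < probit u ∧ probit u < b := by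
    intro a b ha hb
    filter_upwards [Ioo_mem_nhds (strictMono_stdNormalCDF ha) (strictMono_stdNormalCDF hb)]
      with u hu
    obtain ⟨y, hy, rfl⟩ := intermediate_value_Ioo (ha.trans hb).le
      continuous_stdNormalCDF.continuousOn hu
    rw [probit_stdNormalCDF]
    exact hy
  exact ⟨fun a ha => (key a (x + 1) ha (lt_add_one x)).mono fun _ h => h.1,
    fun b hb => (key (x - 1) b (sub_one_lt x) hb).mono fun _ h => h.2⟩

/-- Upper tails of a normal law in terms of `Φ`. -/
theorem gaussianReal_real_Ioi (m c : ℝ) {v : NNReal} (hv : v ≠ 0) :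
    (gaussianReal m v).real (Set.Ioi c) = stdNormalCDF ((m - c) / √v) := by
  have hv' : 0 < √(v : ℝ) := Real.sqrt_pos.2 (by positivity)
  -- The reflection `w ↦ m - √v w` turns the upper tail directly into a lower tail.
  have hmap : gaussianReal m v = (gaussianReal 0 1).map (fun w => m - √v * w) := by
    have h1 : (gaussianReal 0 1).map (fun w => √v * w) = gaussianReal 0 v := by
      rw [gaussianReal_map_const_mul]
      congr 1
      · simp
      · ext; simp
    have h2 : (fun w => m - √v * w) = (fun w => m - w) ∘ fun w => √v * w := rfl
    rw [h2, ← Measure.map_map (by fun_prop) (by fun_prop), h1, gaussianReal_map_const_sub, sub_zero]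
  rw [hmap, map_measureReal_apply (by fun_prop) measurableSet_Ioi, stdNormalCDF_eq_real]
  have : (fun w => m - √v * w) ⁻¹' Set.Ioi c = Set.Iio ((m - c) / √v) := by
    ext w
    simp only [Set.mem_preimage, Set.mem_Ioi, Set.mem_Iio, lt_div_iff₀ hv']
    constructor <;> intro h <;> nlinarith
  rw [this]
  exact measureReal_congr Iio_ae_eq_Iic

/-! ### Bivariate normal orthant probabilities -/

/-- The conditional upper tail probability of the second coordinate given the first one in the
bivariate normal law with correlation `s`. -/
noncomputable def condTail (c s x : ℝ) : ℝ := stdNormalCDF ((s * x - c) / √(1 - s ^ 2))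

theorem continuous_condTail (c s : ℝ) : Continuous (condTail c s) :=
  continuous_stdNormalCDF.comp (by fun_prop)

theorem norm_condTail_le_one (c s x : ℝ) : ‖condTail c s x‖ ≤ 1 := by
  rw [Real.norm_eq_abs, abs_le]
  exact ⟨(neg_nonpos.2 zero_le_one).trans (stdNormalCDF_nonneg _), stdNormalCDF_le_one _⟩

theorem integrable_condTail (c s : ℝ) : Integrable (condTail c s) (gaussianReal 0 1) :=
  Integrable.of_bound (continuous_condTail c s).aestronglyMeasurable 1
    (Eventually.of_forall fun x => norm_condTail_le_one c s x)

theorem one_sub_sq_pos_of_mem {s : ℝ} (hs : s ∈ Set.Ioo (-1 : ℝ) 1) : 0 < 1 - s ^ 2 := by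
  nlinarith [hs.1, hs.2]

theorem toNNReal_one_sub_sq_ne_zero {s : ℝ} (hs : s ∈ Set.Ioo (-1 : ℝ) 1) :
    (1 - s ^ 2).toNNReal ≠ 0 := by
  have := one_sub_sq_pos_of_mem hs
  simpa using this

theorem condTail_eq_real {s : ℝ} (hs : s ∈ Set.Ioo (-1 : ℝ) 1) (c x : ℝ) :
    condTail c s x = (gaussianReal (s * x) (1 - s ^ 2).toNNReal).real (Set.Ioi c) := by
  rw [gaussianReal_real_Ioi _ _ (toNNReal_one_sub_sq_ne_zero hs),
    Real.coe_toNNReal _ (one_sub_sq_pos_of_mem hs).le, condTail]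

/-- If `X` and `N` are independent with laws `N(0, 1)` and `N(0, 1 - s²)`, then `s X + N` is again
standard normal; this is its tail, conditioned on `X`. That the value is free of `s` drives the
monotonicity in `s`. -/
theorem integral_condTail {s : ℝ} (hs : s ∈ Set.Ioo (-1 : ℝ) 1) (c : ℝ) :
    ∫ x, condTail c s x ∂(gaussianReal 0 1) = stdNormalCDF (-c) := by
  have hv := one_sub_sq_pos_of_mem hs
  have hconv : (gaussianReal 0 1).map (fun x => s * x) ∗ gaussianReal 0 (1 - s ^ 2).toNNReal
      = gaussianReal 0 1 := by
    rw [gaussianReal_map_const_mul, gaussianReal_conv_gaussianReal]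
    congr 1
    · simp
    · ext; simp [hv.le]
  have h1 : (gaussianReal 0 1).real (Set.Ioi c) = stdNormalCDF (-c) := by
    rw [gaussianReal_real_Ioi _ _ one_ne_zero]; simp
  rw [← h1]
  nth_rw 2 [← hconv]
  have hi : Integrable ((Set.Ioi c).indicator (1 : ℝ → ℝ))
      ((gaussianReal 0 1).map (fun x => s * x) ∗ gaussianReal 0 (1 - s ^ 2).toNNReal) := by
    rw [hconv]
    exact (integrable_const (1 : ℝ)).indicator measurableSet_Ioi
  rw [← integral_indicator_one measurableSet_Ioi, integral_conv hi, integral_map (by fun_prop)]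
  · congr with x
    rw [condTail_eq_real hs]
    have : gaussianReal (s * x) (1 - s ^ 2).toNNReal
        = (gaussianReal 0 (1 - s ^ 2).toNNReal).map (fun y => s * x + y) := by
      rw [gaussianReal_map_const_add, zero_add]
    rw [this, ← integral_indicator_one measurableSet_Ioi, integral_map (by fun_prop)]
    exact ((measurable_const).indicator measurableSet_Ioi).aestronglyMeasurable
  · refine (Measurable.stronglyMeasurable ?_).integral_prod_right.aestronglyMeasurable
    exact (measurable_const.indicator measurableSet_Ioi).comp (by fun_prop)

/-- Completing the square in `y` factors the density into the marginal of `x` and the conditional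
law `N(s x, 1 - s²)` of `y`. -/
theorem bivTail_integrand_eq {s : ℝ} (hs : s ∈ Set.Ioo (-1 : ℝ) 1) (x y : ℝ) :
    Real.exp (-((x ^ 2 + y ^ 2 - 2 * s * x * y) / (2 * (1 - s ^ 2)))) =
      (2 * Real.pi * √(1 - s ^ 2)) *
        (gaussianPDFReal 0 1 x * gaussianPDFReal (s * x) (1 - s ^ 2).toNNReal y) := by
  have hv := one_sub_sq_pos_of_mem hs
  have hpi := Real.pi_pos
  have hpi2 : √(2 * Real.pi) * √(2 * Real.pi) = 2 * Real.pi :=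
    Real.mul_self_sqrt (by positivity)
  have h1 : √(2 * Real.pi) ≠ 0 := by positivity
  have h2 : √(1 - s ^ 2) ≠ 0 := (Real.sqrt_pos.2 hv).ne'
  simp only [gaussianPDFReal, Real.coe_toNNReal _ hv.le, NNReal.coe_one, mul_one, sub_zero]
  rw [Real.sqrt_mul (by positivity) (1 - s ^ 2), mul_mul_mul_comm (√(2 * Real.pi))⁻¹,
    ← Real.exp_add, ← mul_assoc]
  have : 2 * Real.pi * √(1 - s ^ 2) * ((√(2 * Real.pi))⁻¹ *
      (√(2 * Real.pi) * √(1 - s ^ 2))⁻¹) = 1 := by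
    field_simp; nlinarith
  rw [this, one_mul]
  congr 1
  field_simp
  ring

theorem integrable_bivariate_density {s : ℝ} (hs : s ∈ Set.Ioo (-1 : ℝ) 1) :
    Integrable (fun z : ℝ × ℝ =>
      gaussianPDFReal 0 1 z.1 * gaussianPDFReal (s * z.1) (1 - s ^ 2).toNNReal z.2) := by
  have hm : Measurable (fun z : ℝ × ℝ =>
      gaussianPDFReal 0 1 z.1 * gaussianPDFReal (s * z.1) (1 - s ^ 2).toNNReal z.2) := by
    unfold gaussianPDFReal
    fun_prop
  rw [Measure.volume_eq_prod, integrable_prod_iff hm.aestronglyMeasurable]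
  refine ⟨Eventually.of_forall fun x =>
    (integrable_gaussianPDFReal (s * x) (1 - s ^ 2).toNNReal).const_mul (gaussianPDFReal 0 1 x), ?_⟩
  have : (fun x => ∫ y, ‖gaussianPDFReal 0 1 x *
      gaussianPDFReal (s * x) (1 - s ^ 2).toNNReal y‖) = gaussianPDFReal 0 1 := by
    ext x
    simp only [norm_mul, Real.norm_of_nonneg (gaussianPDFReal_nonneg _ _ _)]
    rw [integral_const_mul, integral_gaussianPDFReal_eq_one _ (toNNReal_one_sub_sq_ne_zero hs),
      mul_one]
  simp only
  rw [this]
  exact integrable_gaussianPDFReal _ _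

theorem bivTail_eq_integral {s : ℝ} (hs : s ∈ Set.Ioo (-1 : ℝ) 1) (c₁ c₂ : ℝ) :
    bivTail c₁ c₂ s = ∫ x in Set.Ioi c₁, condTail c₂ s x ∂(gaussianReal 0 1) := by
  have hv := one_sub_sq_pos_of_mem hs
  have h2 : 2 * Real.pi * √(1 - s ^ 2) ≠ 0 := by
    have := Real.sqrt_pos.2 hv
    positivity
  simp only [bivTail, bivTail_integrand_eq hs]
  rw [integral_const_mul, inv_mul_cancel_left₀ h2, Measure.volume_eq_prod,
    setIntegral_prod _ (by
      rw [← Measure.volume_eq_prod]; exact (integrable_bivariate_density hs).integrableOn)]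
  rw [← integral_indicator measurableSet_Ioi, ← integral_indicator measurableSet_Ioi,
    integral_gaussianReal_eq_integral_smul one_ne_zero]
  congr with x
  by_cases hx : x ∈ Set.Ioi c₁
  · simp only [Set.indicator_of_mem hx, smul_eq_mul]
    rw [integral_const_mul, condTail_eq_real hs, measureReal_def,
      gaussianReal_apply_eq_integral _ (toNNReal_one_sub_sq_ne_zero hs), ENNReal.toReal_ofReal]
    exact integral_nonneg fun y => gaussianPDFReal_nonneg _ _ _
  · simp [Set.indicator_of_notMem hx]

theorem setIntegral_gaussianReal_pos {f : ℝ → ℝ} {S : Set ℝ} (hS : MeasurableSet S)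
    (hf : Integrable f (gaussianReal 0 1)) (hpos : ∀ᵐ x ∂(gaussianReal 0 1), x ∈ S → 0 < f x)
    (hμ : 0 < gaussianReal 0 1 S) : 0 < ∫ x in S, f x ∂(gaussianReal 0 1) := by
  rw [setIntegral_pos_iff_support_of_nonneg_ae _ hf.integrableOn]
  · refine hμ.trans_le (measure_mono_ae ?_)
    filter_upwards [hpos] with x hx hxS
    exact ⟨(hx hxS).ne', hxS⟩
  · rw [EventuallyLE, ae_restrict_iff' hS]
    filter_upwards [hpos] with x hx hxS
    exact (hx hxS).le

/-- The bivariate normal orthant probability strictly increases with the correlation. -/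
theorem strictMonoOn_bivTail (c₁ c₂ : ℝ) :
    StrictMonoOn (bivTail c₁ c₂) (Set.Ioo (-1) 1) := by
  intro s hs t ht hst
  -- `s / √(1 - s²)` is `tan (arcsin s)`, hence increasing.
  have hα : s / √(1 - s ^ 2) < t / √(1 - t ^ 2) := by
    rw [← Real.tan_arcsin, ← Real.tan_arcsin]
    refine Real.strictMonoOn_tan ⟨Real.neg_pi_div_two_lt_arcsin.2 hs.1,
      Real.arcsin_lt_pi_div_two.2 hs.2⟩ ⟨Real.neg_pi_div_two_lt_arcsin.2 ht.1,
      Real.arcsin_lt_pi_div_two.2 ht.2⟩ ?_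
    exact Real.strictMonoOn_arcsin ⟨hs.1.le, hs.2.le⟩ ⟨ht.1.le, ht.2.le⟩ hst
  -- The arguments of `Φ` for `t` and `s` differ by the increasing affine function `α x - β`, so the
  -- difference of conditional tails changes sign exactly once, from negative to positive at `β /
  -- α`. Its total integral is zero, so its integral over any upper half-line is positive: directly
  -- if `c₁` lies beyond the crossing, otherwise because the complementary integral is negative.
  set α := t / √(1 - t ^ 2) - s / √(1 - s ^ 2) with hαdef
  set β := c₂ / √(1 - t ^ 2) - c₂ / √(1 - s ^ 2) with hβdef
  have hαpos : 0 < α := sub_pos.2 hα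
  have hdiff : ∀ x, (t * x - c₂) / √(1 - t ^ 2) - (s * x - c₂) / √(1 - s ^ 2) = α * x - β := by
    intro x; rw [hαdef, hβdef]; ring
  have hpos : ∀ x, β / α < x → condTail c₂ s x < condTail c₂ t x := by
    intro x hx
    rw [div_lt_iff₀ hαpos] at hx
    exact strictMono_stdNormalCDF (by linarith [hdiff x])
  have hneg : ∀ x, x < β / α → condTail c₂ t x < condTail c₂ s x := by
    intro x hx
    rw [lt_div_iff₀ hαpos] at hx
    exact strictMono_stdNormalCDF (by linarith [hdiff x])
  have hint := (integrable_condTail c₂ t).sub (integrable_condTail c₂ s)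
  have htot : ∫ x, (condTail c₂ t - condTail c₂ s) x ∂(gaussianReal 0 1) = 0 := by
    simp only [Pi.sub_apply]
    rw [integral_sub (integrable_condTail c₂ t) (integrable_condTail c₂ s),
      integral_condTail hs, integral_condTail ht, sub_self]
  rw [bivTail_eq_integral hs, bivTail_eq_integral ht, ← sub_pos,
    ← integral_sub (integrable_condTail c₂ t).integrableOn (integrable_condTail c₂ s).integrableOn]
  rcases le_total (β / α) c₁ with h | h
  · refine setIntegral_gaussianReal_pos measurableSet_Ioi hint
      (Eventually.of_forall fun x hx => ?_)
      (gaussianReal_pos_of_isOpen isOpen_Ioi Set.nonempty_Ioi)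
    exact sub_pos.2 (hpos x (h.trans_lt hx))
  · have hsplit := integral_add_compl (measurableSet_Ioi (a := c₁)) hint
    rw [htot, Set.compl_Ioi] at hsplit
    have hm : 0 < ∫ x in Set.Iic c₁, -(condTail c₂ t - condTail c₂ s) x ∂(gaussianReal 0 1) := by
      refine setIntegral_gaussianReal_pos measurableSet_Iic hint.neg ?_ ?_
      · have : ∀ᵐ w ∂(gaussianReal 0 1), w ≠ c₁ := by simp [ae_iff]
        filter_upwards [this] with x hx hxS
        have := hneg x ((lt_of_le_of_ne hxS hx).trans_le h)
        simp only [Pi.sub_apply]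
        linarith
      · exact (gaussianReal_pos_of_isOpen isOpen_Iio Set.nonempty_Iio).trans_le
          (measure_mono Set.Iio_subset_Iic_self)
    rw [integral_neg] at hm
    simp only [Pi.sub_apply] at hm hsplit ⊢
    linarith

/-- Dominated convergence in the conditional form: at the base point the integrand can jump only at
`w = c₁`, a null set. -/
theorem continuousAt_bivTail (c₁ c₂ : ℝ) {s : ℝ} (hs : s ∈ Set.Ioo (-1 : ℝ) 1) :
    ContinuousAt (fun z : ℝ × ℝ × ℝ => bivTail z.1 z.2.1 z.2.2) (c₁, c₂, s) := by
  have hnear : ∀ᶠ z : ℝ × ℝ × ℝ in 𝓝 (c₁, c₂, s), z.2.2 ∈ Set.Ioo (-1 : ℝ) 1 :=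
    (continuous_snd.snd.tendsto (c₁, c₂, s)).eventually (Ioo_mem_nhds hs.1 hs.2)
  have heq : (fun z : ℝ × ℝ × ℝ => bivTail z.1 z.2.1 z.2.2) =ᶠ[𝓝 (c₁, c₂, s)]
      fun z => ∫ x, (Set.Ioi z.1).indicator (condTail z.2.1 z.2.2) x ∂(gaussianReal 0 1) := by
    filter_upwards [hnear] with z hz
    rw [bivTail_eq_integral hz, integral_indicator measurableSet_Ioi]
  refine ContinuousAt.congr ?_ heq.symm
  refine continuousAt_of_dominated (bound := fun _ => 1) (Eventually.of_forall fun z => ?_)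
    (Eventually.of_forall fun z => Eventually.of_forall fun w => ?_) (integrable_const _) ?_
  · exact ((continuous_condTail _ _).measurable.indicator measurableSet_Ioi).aestronglyMeasurable
  · exact (norm_indicator_le_norm_self _ _).trans (norm_condTail_le_one _ _ _)
  · have : ∀ᵐ w ∂(gaussianReal 0 1), w ≠ c₁ := by simp [ae_iff]
    filter_upwards [this] with w hw
    have hcont : ContinuousAt (fun z : ℝ × ℝ × ℝ => condTail z.2.1 z.2.2 w) (c₁, c₂, s) := by
      refine continuous_stdNormalCDF.continuousAt.comp (f := fun z : ℝ × ℝ × ℝ =>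
        (z.2.2 * w - z.2.1) / √(1 - z.2.2 ^ 2)) (ContinuousAt.div (by fun_prop) (by fun_prop) ?_)
      exact (Real.sqrt_pos.2 (one_sub_sq_pos_of_mem hs)).ne'
    rcases lt_or_gt_of_ne hw with h | h
    · refine continuousAt_const (y := (0 : ℝ)) |>.congr ?_
      filter_upwards [(continuous_fst.tendsto (c₁, c₂, s)).eventually (lt_mem_nhds h)] with z hz
      simp [hz.le]
    · refine hcont.congr ?_
      filter_upwards [(continuous_fst.tendsto (c₁, c₂, s)).eventually (gt_mem_nhds h)] with z hz
      rw [Set.indicator_of_mem (Set.mem_Ioi.2 hz)]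

theorem bivTailInv_bivTail (c₁ c₂ : ℝ) {s : ℝ} (hs : s ∈ Set.Ioo (-1 : ℝ) 1) :
    bivTailInv c₁ c₂ (bivTail c₁ c₂ s) = s :=
  (strictMonoOn_bivTail c₁ c₂).injOn.leftInvOn_invFunOn hs

/-! ### Continuity of the correlation estimator -/

/-- The correlation estimator as a function of the three empirical frequencies. -/
noncomputable def corrEst (u : ℝ × ℝ × ℝ) : ℝ := bivTailInv (-probit u.1) (-probit u.2.1) u.2.2

/-- The true probabilities as a function of the thresholds and the correlation. -/
noncomputable def cellProbs (z : ℝ × ℝ × ℝ) : ℝ × ℝ × ℝ :=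
  (stdNormalCDF (-z.1), stdNormalCDF (-z.2.1), bivTail z.1 z.2.1 z.2.2)

theorem corrEst_cellProbs (c₁ c₂ : ℝ) {s : ℝ} (hs : s ∈ Set.Ioo (-1 : ℝ) 1) :
    corrEst (cellProbs (c₁, c₂, s)) = s := by
  simp only [corrEst, cellProbs, probit_stdNormalCDF, neg_neg, bivTailInv_bivTail _ _ hs]

/-- For `a < s < b`, strict monotonicity gives strict inequalities between the tails at `a`, `s`,
`b`, and these persist under small changes of the three frequencies. The intermediate value theorem
then produces a solution in `(a, b)`, and injectivity identifies it with `corrEst`. -/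
theorem continuousAt_corrEst (c₁ c₂ : ℝ) {s : ℝ} (hs : s ∈ Set.Ioo (-1 : ℝ) 1) :
    ContinuousAt corrEst (cellProbs (c₁, c₂, s)) := by
  set u₀ := cellProbs (c₁, c₂, s) with hu₀
  have hcont : ∀ a ∈ Set.Ioo (-1 : ℝ) 1,
      Tendsto (fun u : ℝ × ℝ × ℝ => bivTail (-probit u.1) (-probit u.2.1) a) (𝓝 u₀)
        (𝓝 (bivTail c₁ c₂ a)) := by
    intro a ha
    have h1 : ContinuousAt (fun u : ℝ × ℝ × ℝ => (-probit u.1, -probit u.2.1, a)) u₀ := by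
      refine ContinuousAt.prodMk ?_ (ContinuousAt.prodMk ?_ continuousAt_const)
      · exact ((continuousAt_probit (-c₁)).comp_of_eq continuousAt_fst rfl).neg
      · exact ((continuousAt_probit (-c₂)).comp_of_eq
          (f := fun u : ℝ × ℝ × ℝ => u.2.1) (by fun_prop) rfl).neg
    have h2 : (-probit u₀.1, -probit u₀.2.1, a) = (c₁, c₂, a) := by
      simp [hu₀, cellProbs, probit_stdNormalCDF]
    have h3 := (continuousAt_bivTail c₁ c₂ ha).comp_of_eq h1 h2
    have h4 := h3.tendsto
    simp only [Function.comp_def] at h4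
    rwa [show -probit u₀.1 = c₁ from congrArg Prod.fst h2,
      show -probit u₀.2.1 = c₂ from congrArg (fun z => z.2.1) h2] at h4
  rw [ContinuousAt, corrEst_cellProbs _ _ hs, tendsto_order]
  have key : ∀ a ∈ Set.Ioo (-1 : ℝ) 1, ∀ b ∈ Set.Ioo (-1 : ℝ) 1, a < s → s < b →
      ∀ᶠ u in 𝓝 u₀, a < corrEst u ∧ corrEst u < b := by
    intro a ha b hb has hsb
    have hP : Tendsto (fun u : ℝ × ℝ × ℝ => u.2.2) (𝓝 u₀) (𝓝 (bivTail c₁ c₂ s)) :=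
      continuous_snd.snd.tendsto u₀
    filter_upwards [(hcont a ha).eventually_lt hP (strictMonoOn_bivTail c₁ c₂ ha hs has),
      hP.eventually_lt (hcont b hb) (strictMonoOn_bivTail c₁ c₂ hs hb hsb)] with u h1 h2
    have hsub : Set.Icc a b ⊆ Set.Ioo (-1 : ℝ) 1 := fun x hx =>
      ⟨ha.1.trans_le hx.1, hx.2.trans_lt hb.2⟩
    have hc : ContinuousOn (bivTail (-probit u.1) (-probit u.2.1)) (Set.Icc a b) := by
      intro x hx
      have h1 : ContinuousAt (fun y : ℝ => (-probit u.1, -probit u.2.1, y)) x := by fun_prop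
      exact (ContinuousAt.comp (f := fun y : ℝ => (-probit u.1, -probit u.2.1, y))
        (continuousAt_bivTail _ _ (hsub hx)) h1).continuousWithinAt
    obtain ⟨y, hy, hyP⟩ := intermediate_value_Ioo (has.trans hsb).le hc ⟨h1, h2⟩
    have : corrEst u = y := by
      rw [corrEst, ← hyP, bivTailInv_bivTail _ _ (hsub (Set.Ioo_subset_Icc_self hy))]
    rw [this]
    exact hy
  -- Arbitrary bounds around `s` are cut off at `a₀` and `b₀`, so that the test correlations stay
  -- inside `(-1, 1)`.
  obtain ⟨a₀, ha₀, ha₀s⟩ := exists_between hs.1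
  obtain ⟨b₀, hb₀, hb₀s⟩ := exists_between hs.2
  have ha₀' : a₀ ∈ Set.Ioo (-1 : ℝ) 1 := ⟨ha₀, ha₀s.trans hs.2⟩
  have hb₀' : b₀ ∈ Set.Ioo (-1 : ℝ) 1 := ⟨hs.1.trans hb₀, hb₀s⟩
  refine ⟨fun a ha => ?_, fun b hb => ?_⟩
  · exact (key (max a a₀) ⟨ha₀.trans_le (le_max_right _ _), (max_lt ha ha₀s).trans hs.2⟩ b₀ hb₀'
      (max_lt ha ha₀s) hb₀).mono fun u hu => (le_max_left _ _).trans_lt hu.1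
  · exact (key a₀ ha₀' (min b b₀) ⟨hs.1.trans (lt_min hb hb₀), (min_le_right _ _).trans_lt hb₀s⟩
      ha₀s (lt_min hb hb₀)).mono fun u hu => hu.2.trans_le (min_le_left _ _)

/-- Uniform consistency of the correlation estimator for thresholds in a bounded interval and
correlations bounded away from `±1`. -/
theorem corrEst_uniformly_close (a b r : ℝ) (hr : r < 1) {η : ℝ} (hη : 0 < η) :
    ∃ δ > 0, ∀ c₁ ∈ Set.Icc a b, ∀ c₂ ∈ Set.Icc a b, ∀ s ∈ Set.Icc (-r) r,
      ∀ u : ℝ × ℝ × ℝ, dist u (cellProbs (c₁, c₂, s)) < δ → |corrEst u - s| < η := by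
  set K := Set.Icc a b ×ˢ (Set.Icc a b ×ˢ Set.Icc (-r) r)
  have hK : IsCompact K := isCompact_Icc.prod (isCompact_Icc.prod isCompact_Icc)
  have hmem : ∀ s ∈ Set.Icc (-r) r, s ∈ Set.Ioo (-1 : ℝ) 1 := fun s hs =>
    ⟨by linarith [hs.1], by linarith [hs.2]⟩
  have hcont : ContinuousOn cellProbs K := by
    rintro ⟨c₁, c₂, s⟩ ⟨-, -, h3⟩
    refine ContinuousAt.continuousWithinAt ?_
    refine ContinuousAt.prodMk ?_ (ContinuousAt.prodMk ?_ (continuousAt_bivTail _ _ (hmem s h3)))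
    · exact (continuous_stdNormalCDF.comp (by fun_prop)).continuousAt
    · exact (continuous_stdNormalCDF.comp (by fun_prop)).continuousAt
  -- Only one of the two points must lie in the compact image. The other, the empirical triple, is
  -- arbitrary and need not be a triple of true probabilities.
  have huc := (hK.image_of_continuousOn hcont).uniformContinuousAt_of_continuousAt corrEst (by
    rintro _ ⟨⟨c₁, c₂, s⟩, ⟨-, -, h3⟩, rfl⟩
    exact continuousAt_corrEst _ _ (hmem s h3)) (Metric.dist_mem_uniformity hη)
  obtain ⟨δ, hδ, h⟩ := Metric.mem_uniformity_dist.1 huc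
  refine ⟨δ, hδ, fun c₁ h1 c₂ h2 s h3 u hu => ?_⟩
  have hd : dist (corrEst (cellProbs (c₁, c₂, s))) (corrEst u) < η :=
    h (by rwa [dist_comm] at hu) (Set.mem_image_of_mem cellProbs
      (show (c₁, c₂, s) ∈ K from ⟨h1, h2, h3⟩))
  rwa [corrEst_cellProbs _ _ (hmem s h3), dist_comm, Real.dist_eq] at hd

/-! ### Projections, Ky Fan's principle and the perturbation bound -/

section LinearAlgebra

open scoped Matrix.Norms.Frobenius

variable {p d : ℕ}

theorem frobenius_norm_eq_sqrt (M : Matrix (Fin p) (Fin p) ℝ) :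
    ‖M‖ = √(∑ j, ∑ k, M j k ^ 2) := by
  rw [Matrix.frobenius_norm_def, Real.sqrt_eq_rpow]
  simp

/-- Cauchy–Schwarz over all index pairs, applied to `M` and `Nᵀ`. -/
theorem sum_abs_diag_mul_le (M N : Matrix (Fin p) (Fin p) ℝ) :
    ∑ j, |(M * N) j j| ≤ ‖M‖ * ‖N‖ := by
  have h1 : ∀ j, |(M * N) j j| ≤ ∑ k, |M j k| * |Nᵀ j k| := fun j => by
    rw [Matrix.mul_apply]
    refine (Finset.abs_sum_le_sum_abs _ _).trans (le_of_eq ?_)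
    simp [abs_mul]
  refine (Finset.sum_le_sum fun j _ => h1 j).trans ?_
  rw [← Matrix.frobenius_norm_transpose N, frobenius_norm_eq_sqrt, frobenius_norm_eq_sqrt,
    ← Finset.sum_product', ← Finset.sum_product', ← Finset.sum_product']
  refine (Real.sum_mul_le_sqrt_mul_sqrt _ (fun x : Fin p × Fin p => |M x.1 x.2|)
    fun x : Fin p × Fin p => |Nᵀ x.1 x.2|).trans (le_of_eq ?_)
  simp

theorem abs_trace_mul_le (M N : Matrix (Fin p) (Fin p) ℝ) : |(M * N).trace| ≤ ‖M‖ * ‖N‖ :=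
  (Finset.abs_sum_le_sum_abs _ _).trans (sum_abs_diag_mul_le M N)

/-- Orthogonal projections of rank `d`. -/
structure IsOrthProj (d : ℕ) (P : Matrix (Fin p) (Fin p) ℝ) : Prop where
  transpose_eq : Pᵀ = P
  mul_self : P * P = P
  trace_eq : P.trace = d

namespace IsOrthProj

variable {P R : Matrix (Fin p) (Fin p) ℝ}

theorem diag_eq (hP : IsOrthProj d P) (j : Fin p) : P j j = ∑ k, P j k ^ 2 := by
  conv_lhs => rw [← hP.mul_self]
  rw [Matrix.mul_apply]
  refine Finset.sum_congr rfl fun k _ => ?_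
  rw [sq, ← Matrix.transpose_apply P j k, hP.transpose_eq]

theorem diag_nonneg (hP : IsOrthProj d P) (j : Fin p) : 0 ≤ P j j := by
  rw [hP.diag_eq]; positivity

theorem diag_le_one (hP : IsOrthProj d P) (j : Fin p) : P j j ≤ 1 := by
  have h := hP.diag_eq j
  have h2 : P j j ^ 2 ≤ ∑ k, P j k ^ 2 :=
    Finset.single_le_sum (f := fun k => P j k ^ 2) (fun k _ => sq_nonneg _) (Finset.mem_univ j)
  nlinarith

theorem norm_sq (hP : IsOrthProj d P) : ‖P‖ ^ 2 = d := by
  rw [frobenius_norm_eq_sqrt, Real.sq_sqrt (by positivity), ← hP.trace_eq]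
  exact Finset.sum_congr rfl fun j _ => (hP.diag_eq j).symm

theorem norm_le (hP : IsOrthProj d P) : ‖P‖ ≤ d := by
  refine le_of_sq_le_sq ?_ (Nat.cast_nonneg d)
  rw [hP.norm_sq]
  exact_mod_cast Nat.le_self_pow two_ne_zero d

theorem trace_mul_diagonal_nonneg (hP : IsOrthProj d P) {v : Fin p → ℝ} (hv : ∀ j, 0 ≤ v j) :
    0 ≤ (P * Matrix.diagonal v).trace := by
  simp only [Matrix.trace, Matrix.diag_apply, Matrix.mul_diagonal]
  exact Finset.sum_nonneg fun j _ => mul_nonneg (hP.diag_nonneg j) (hv j)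

theorem trace_mul_diagonal_le (hP : IsOrthProj d P) {v : Fin p → ℝ} (hv : ∀ j, v j ≤ 1) :
    (P * Matrix.diagonal v).trace ≤ d := by
  rw [← hP.trace_eq]
  simp only [Matrix.trace, Matrix.diag_apply, Matrix.mul_diagonal]
  exact Finset.sum_le_sum fun j _ => mul_le_of_le_one_right (hP.diag_nonneg j) (hv j)

theorem conj {U : Matrix (Fin p) (Fin p) ℝ} (hP : IsOrthProj d P) (hU : U * Uᵀ = 1) :
    IsOrthProj d (Uᵀ * P * U) where
  transpose_eq := by
    rw [Matrix.transpose_mul, Matrix.transpose_mul, hP.transpose_eq, Matrix.transpose_transpose,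
      Matrix.mul_assoc]
  mul_self := by
    calc Uᵀ * P * U * (Uᵀ * P * U) = Uᵀ * P * (U * Uᵀ) * P * U := by simp only [Matrix.mul_assoc]
      _ = Uᵀ * (P * P) * U := by rw [hU, Matrix.mul_one]; simp only [Matrix.mul_assoc]
      _ = Uᵀ * P * U := by rw [hP.mul_self]
  trace_eq := by
    rw [Matrix.trace_mul_comm, ← Matrix.mul_assoc, hU, Matrix.one_mul, hP.trace_eq]

end IsOrthProj

theorem submatrix_mul_submatrix_id {m : ℕ} (M N : Matrix (Fin p) (Fin p) ℝ) (f : Fin m → Fin p) :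
    M.submatrix f id * N.submatrix id f = (M * N).submatrix f f := rfl

theorem IsLeadingEigenvectors.isOrthProj {A : Matrix (Fin p) (Fin p) ℝ}
    {V : Matrix (Fin p) (Fin d) ℝ} (h : IsLeadingEigenvectors A V) : IsOrthProj d (V * Vᵀ) := by
  obtain ⟨hd, U, lam, hU, -, -, rfl⟩ := h
  have hV : (U.submatrix id (Fin.castLE hd))ᵀ * U.submatrix id (Fin.castLE hd) = 1 := by
    rw [Matrix.transpose_submatrix, submatrix_mul_submatrix_id, hU,
      Matrix.submatrix_one _ (Fin.castLE_injective hd)]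
  set V := U.submatrix id (Fin.castLE hd)
  refine ⟨by rw [Matrix.transpose_mul, Matrix.transpose_transpose], ?_, ?_⟩
  · rw [Matrix.mul_assoc, ← Matrix.mul_assoc Vᵀ, hV, Matrix.one_mul]
  · rw [Matrix.trace_mul_comm, hV]; simp

/-- Weights in `[0, 1]` of total mass `d` against a decreasing sequence are best placed on the
first `d` indices. -/
theorem sum_mul_le_sum_leading (hd : d ≤ p) {lam r : Fin p → ℝ} (hlam : Antitone lam)
    (hr0 : ∀ i, 0 ≤ r i) (hr1 : ∀ i, r i ≤ 1) (hr : ∑ i, r i = d) :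
    ∑ i, lam i * r i ≤ ∑ k : Fin d, lam (Fin.castLE hd k) := by
  classical
  -- A level `t` separates the first `d` values from the rest, so every `(lam i - t) * (w i - r i)`
  -- is nonnegative; in the sum `t` cancels because both weights have mass `d`. For `d = 0` there is
  -- no last leading value, and any upper bound of `lam` serves.
  obtain ⟨t, ht1, ht2⟩ : ∃ t, (∀ i : Fin p, (i : ℕ) < d → t ≤ lam i) ∧
      ∀ i : Fin p, ¬ (i : ℕ) < d → lam i ≤ t := by
    rcases Nat.eq_zero_or_pos d with h0 | h0
    · refine ⟨∑ i, |lam i|, fun i hi => by omega, fun i _ => (le_abs_self _).trans ?_⟩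
      exact Finset.single_le_sum (f := fun i => |lam i|) (fun _ _ => abs_nonneg _)
        (Finset.mem_univ i)
    · refine ⟨lam ⟨d - 1, by omega⟩, fun i hi => hlam ?_, fun i hi => hlam ?_⟩ <;>
      · rw [Fin.le_def]; simp only; omega
  set w : Fin p → ℝ := fun i => if (i : ℕ) < d then 1 else 0 with hw
  have hsum : ∀ f : Fin p → ℝ, ∑ i, f i * w i = ∑ k : Fin d, f (Fin.castLE hd k) := by
    intro f
    simp only [hw, mul_ite, mul_one, mul_zero]
    rw [← Finset.sum_filter]
    symm
    refine Finset.sum_bij (fun k _ => Fin.castLE hd k) ?_ ?_ ?_ ?_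
    · intro k _; simp
    · intro a _ b _ h; exact Fin.castLE_injective hd h
    · intro i hi
      exact ⟨⟨i, (Finset.mem_filter.1 hi).2⟩, Finset.mem_univ _, rfl⟩
    · intro k _; rfl
  rw [← hsum lam]
  have hw1 : ∑ i, w i = d := by
    have := hsum fun _ => 1
    simpa using this
  have hterm : ∀ i, 0 ≤ (lam i - t) * (w i - r i) := by
    intro i
    by_cases hi : (i : ℕ) < d
    · simp only [hw, hi, if_true]
      exact mul_nonneg (sub_nonneg.2 (ht1 i hi)) (sub_nonneg.2 (hr1 i))
    · simp only [hw, hi, if_false]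
      exact mul_nonneg_of_nonpos_of_nonpos (sub_nonpos.2 (ht2 i hi)) (by linarith [hr0 i])
  have htot := Finset.sum_nonneg fun i (_ : i ∈ Finset.univ) => hterm i
  have hexp : ∑ i, (lam i - t) * (w i - r i)
      = ∑ i, lam i * w i - ∑ i, lam i * r i - t * (∑ i, w i - ∑ i, r i) := by
    rw [← Finset.sum_sub_distrib, ← Finset.sum_sub_distrib, Finset.mul_sum,
      ← Finset.sum_sub_distrib]
    exact Finset.sum_congr rfl fun i _ => by ring
  rw [hexp, hw1, hr] at htot
  linarith

/-- Ky Fan's maximum principle. -/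
theorem IsLeadingEigenvectors.trace_mul_le {A R : Matrix (Fin p) (Fin p) ℝ}
    {V : Matrix (Fin p) (Fin d) ℝ} (h : IsLeadingEigenvectors A V) (hR : IsOrthProj d R) :
    (R * A).trace ≤ (V * Vᵀ * A).trace := by
  obtain ⟨hd, U, lam, hU, hlam, hAU, rfl⟩ := h
  have hU' : U * Uᵀ = 1 := mul_eq_one_comm.1 hU
  have hA : A = U * Matrix.diagonal lam * Uᵀ := by
    rw [← hAU, Matrix.mul_assoc, hU', Matrix.mul_one]
  -- In the eigenbasis, `tr (R A)` weights the eigenvalues by the diagonal of `Uᵀ R U`, which lies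
  -- in `[0, 1]` and sums to `d`.
  have hS := hR.conj hU'
  have h1 : (R * A).trace = ∑ i, lam i * (Uᵀ * R * U) i i := by
    have : (R * A).trace = (Uᵀ * R * U * Matrix.diagonal lam).trace := by
      rw [hA, Matrix.mul_assoc Uᵀ, Matrix.mul_assoc Uᵀ, Matrix.trace_mul_comm Uᵀ]
      simp only [Matrix.mul_assoc]
    rw [this]
    simp only [Matrix.trace, Matrix.diag_apply, Matrix.mul_diagonal, mul_comm]
  have h2 : (U.submatrix id (Fin.castLE hd) * (U.submatrix id (Fin.castLE hd))ᵀ * A).trace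
      = ∑ k : Fin d, lam (Fin.castLE hd k) := by
    have hAV : A * U.submatrix id (Fin.castLE hd)
        = (U * Matrix.diagonal lam).submatrix id (Fin.castLE hd) := by
      rw [← hAU]; rfl
    rw [Matrix.mul_assoc, Matrix.trace_mul_comm, Matrix.mul_assoc, hAV,
      Matrix.transpose_submatrix, submatrix_mul_submatrix_id, ← Matrix.mul_assoc, hU, Matrix.one_mul]
    simp [Matrix.trace]
  rw [h1, h2]
  exact sum_mul_le_sum_leading hd hlam hS.diag_nonneg hS.diag_le_one hS.trace_eq

/-- The range of a `p × d` matrix is contained in that of a rank `d` orthogonal projection. -/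
theorem exists_isOrthProj_mul_eq (hd : d ≤ p) (B : Matrix (Fin p) (Fin d) ℝ) :
    ∃ R, IsOrthProj d R ∧ R * (B * Bᵀ) = B * Bᵀ := by
  classical
  have hH : (B * Bᵀ).IsHermitian := by
    simpa using Matrix.isHermitian_mul_conjTranspose_self B
  have hrank : (Finset.univ.filter fun i => hH.eigenvalues i ≠ 0).card ≤ d := by
    rw [← Fintype.card_subtype, ← hH.rank_eq_card_non_zero_eigs]
    exact (Matrix.rank_mul_le_left _ _).trans ((Matrix.rank_le_card_width B).trans_eq (by simp))
  -- The set of nonzero eigenvalues is padded to exactly `d` indices: the comparison by Ky Fan needs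
  -- trace `d` even when `B` has smaller rank.
  obtain ⟨S, hS, hScard⟩ := Finset.exists_superset_card_eq hrank (by simpa using hd)
  set W : Matrix (Fin p) (Fin p) ℝ := hH.eigenvectorUnitary.1 with hW
  have hWW : Wᵀ * W = 1 := by
    simpa [Matrix.star_eq_conjTranspose] using Unitary.coe_star_mul_self hH.eigenvectorUnitary
  have hB : B * Bᵀ = W * Matrix.diagonal hH.eigenvalues * Wᵀ := by
    have := hH.spectral_theorem
    rw [Unitary.conjStarAlgAut_apply] at this
    simpa [Matrix.star_eq_conjTranspose, Function.comp_def] using this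
  have hproj : IsOrthProj d (Matrix.diagonal fun i => if i ∈ S then (1 : ℝ) else 0) := by
    refine ⟨Matrix.diagonal_transpose _, ?_, ?_⟩
    · rw [Matrix.diagonal_mul_diagonal]; congr 1; ext i; simp
    · rw [Matrix.trace_diagonal, Finset.sum_ite_mem]; simp [hScard]
  refine ⟨W * (Matrix.diagonal fun i => if i ∈ S then (1 : ℝ) else 0) * Wᵀ, ?_, ?_⟩
  · simpa using hproj.conj (U := Wᵀ) (by simpa using hWW)
  · rw [hB]
    calc _ = W * (Matrix.diagonal fun i => if i ∈ S then (1 : ℝ) else 0) * (Wᵀ * W) *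
            Matrix.diagonal hH.eigenvalues * Wᵀ := by simp only [Matrix.mul_assoc]
      _ = W * ((Matrix.diagonal fun i => if i ∈ S then (1 : ℝ) else 0) *
            Matrix.diagonal hH.eigenvalues) * Wᵀ := by
          rw [hWW, Matrix.mul_one]; simp only [Matrix.mul_assoc]
      _ = _ := by
          rw [Matrix.diagonal_mul_diagonal]
          congr 3; ext i
          by_cases hi : i ∈ S
          · simp [hi]
          · have : hH.eigenvalues i = 0 := by
              by_contra h0
              exact hi (hS (by simpa using h0))
            simp [this]

theorem compl_proj_mul (P M : Matrix (Fin p) (Fin p) ℝ) :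
    (1 - P) * M * (1 - P) = M - P * M - M * P + P * M * P := by
  noncomm_ring

/-- The error is `-P D - D P + P D P`, and each of the three products has nonnegative diagonal and
trace at most `tr P = d`. -/
theorem IsOrthProj.sum_abs_diag_diagonal_le {P : Matrix (Fin p) (Fin p) ℝ} (hP : IsOrthProj d P)
    {v : Fin p → ℝ} (hv : ∀ j, v j ∈ Set.Icc (0 : ℝ) 1) :
    ∑ j, |((1 - P) * Matrix.diagonal v * (1 - P)) j j - v j| ≤ 3 * d := by
  have h1 : ∀ j, |((1 - P) * Matrix.diagonal v * (1 - P)) j j - v j|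
      ≤ 2 * (P * Matrix.diagonal v) j j + (P * Matrix.diagonal v * P) j j := by
    intro j
    have h2 : 0 ≤ (P * Matrix.diagonal v * P) j j := by
      rw [Matrix.mul_apply]
      refine Finset.sum_nonneg fun k _ => ?_
      rw [Matrix.mul_diagonal, ← Matrix.transpose_apply P j k, hP.transpose_eq]
      nlinarith [mul_nonneg (sq_nonneg (P j k)) (hv k).1]
    have h3 : 0 ≤ (P * Matrix.diagonal v) j j := by
      rw [Matrix.mul_diagonal]; exact mul_nonneg (hP.diag_nonneg j) (hv j).1
    have h4 : (Matrix.diagonal v * P) j j = (P * Matrix.diagonal v) j j := by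
      rw [Matrix.mul_diagonal, Matrix.diagonal_mul, mul_comm]
    rw [compl_proj_mul]
    simp only [Matrix.add_apply, Matrix.sub_apply, Matrix.diagonal_apply_eq, h4]
    rw [abs_le]
    constructor <;> linarith
  refine (Finset.sum_le_sum fun j _ => h1 j).trans ?_
  rw [Finset.sum_add_distrib, ← Finset.mul_sum]
  have h5 : ∑ j, (P * Matrix.diagonal v) j j ≤ d := hP.trace_mul_diagonal_le fun j => (hv j).2
  have h6 : ∑ j, (P * Matrix.diagonal v * P) j j ≤ d := by
    have : ∑ j, (P * Matrix.diagonal v * P) j j = (P * Matrix.diagonal v).trace := by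
      change (P * Matrix.diagonal v * P).trace = _
      rw [Matrix.trace_mul_comm, ← Matrix.mul_assoc, hP.mul_self]
    rw [this]
    exact h5
  linarith

/-- With zero diagonal, `E` itself drops out and every remaining term carries a factor `P`. The
bound therefore involves `d` and not the `√p` that Cauchy–Schwarz would give for the diagonal of
`E`. -/
theorem IsOrthProj.sum_abs_diag_compl_le {P E : Matrix (Fin p) (Fin p) ℝ} (hP : IsOrthProj d P)
    (hE : ∀ j, E j j = 0) :
    ∑ j, |((1 - P) * E * (1 - P)) j j| ≤ 3 * d * ‖E‖ := by
  have h1 : ∀ j, |((1 - P) * E * (1 - P)) j j|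
      ≤ |(P * E) j j| + |(E * P) j j| + |(P * (E * P)) j j| := by
    intro j
    rw [compl_proj_mul, ← Matrix.mul_assoc P E P]
    simp only [Matrix.add_apply, Matrix.sub_apply, hE j]
    refine (abs_add_le _ _).trans (add_le_add ?_ le_rfl)
    rw [zero_sub, ← neg_add', abs_neg]
    exact abs_add_le _ _
  refine (Finset.sum_le_sum fun j _ => h1 j).trans ?_
  rw [Finset.sum_add_distrib, Finset.sum_add_distrib]
  have hE0 : 0 ≤ ‖E‖ := norm_nonneg E
  have a1 := sum_abs_diag_mul_le P E
  have a2 := sum_abs_diag_mul_le E P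
  have a3 := sum_abs_diag_mul_le P (E * P)
  have a4 := mul_le_mul_of_nonneg_left (Matrix.frobenius_norm_mul E P) (norm_nonneg P)
  have a5 : ‖P‖ * (‖E‖ * ‖P‖) = d * ‖E‖ := by rw [← hP.norm_sq]; ring
  have a6 := mul_le_mul_of_nonneg_right hP.norm_le hE0
  nlinarith

/-- The factor part left over after projecting out the leading eigenvectors. -/
theorem IsLeadingEigenvectors.sum_diag_factor_le {A : Matrix (Fin p) (Fin p) ℝ}
    {V : Matrix (Fin p) (Fin d) ℝ} (h : IsLeadingEigenvectors A V) (B : Matrix (Fin p) (Fin d) ℝ)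
    {v : Fin p → ℝ} (hv : ∀ j, v j ∈ Set.Icc (0 : ℝ) 1) :
    ∑ j, |((1 - V * Vᵀ) * (B * Bᵀ) * (1 - V * Vᵀ) : Matrix (Fin p) (Fin p) ℝ) j j|
      ≤ d + 2 * d * ‖A - B * Bᵀ - Matrix.diagonal v‖ := by
  have hP := h.isOrthProj
  set P := V * Vᵀ with hPdef
  set E := A - B * Bᵀ - Matrix.diagonal v with hE
  have hsq : (1 - P) * (1 - P) = 1 - P := by
    have : (1 - P) * (1 - P) = 1 - P - P + P * P := by noncomm_ring
    rw [this, hP.mul_self]; abel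
  have hnn : ∀ j, 0 ≤ ((1 - P) * (B * Bᵀ) * (1 - P) : Matrix (Fin p) (Fin p) ℝ) j j := by
    intro j
    have : (1 - P) * (B * Bᵀ) * (1 - P) = (1 - P) * B * ((1 - P) * B)ᵀ := by
      rw [Matrix.transpose_mul, Matrix.transpose_sub, hP.transpose_eq, Matrix.transpose_one]
      simp only [Matrix.mul_assoc]
    rw [this, Matrix.mul_apply]
    exact Finset.sum_nonneg fun k _ => by rw [Matrix.transpose_apply]; exact mul_self_nonneg _
  simp only [abs_of_nonneg (hnn _)]
  -- Since `R` fixes `B Bᵀ`, the leftover trace is `tr (R B Bᵀ) - tr (P B Bᵀ)`. Substituting `B Bᵀ =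
  -- A - D - E` leaves a Ky Fan difference, which is at most zero, plus terms in `D` (at most `d`)
  -- and in `E` (at most `2d ‖E‖`).
  obtain ⟨R, hR, hRB⟩ := exists_isOrthProj_mul_eq h.1 B
  have htr : ∑ j, ((1 - P) * (B * Bᵀ) * (1 - P) : Matrix (Fin p) (Fin p) ℝ) j j
      = (R * (B * Bᵀ)).trace - (P * (B * Bᵀ)).trace := by
    change ((1 - P) * (B * Bᵀ) * (1 - P)).trace = _
    rw [Matrix.trace_mul_comm, ← Matrix.mul_assoc, hsq, Matrix.sub_mul, Matrix.one_mul,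
      Matrix.trace_sub, hRB]
  have hBB : B * Bᵀ = A - Matrix.diagonal v - E := by rw [hE]; abel
  have hKF := h.trace_mul_le hR
  rw [← hPdef] at hKF
  rw [htr]
  conv_lhs => rw [hBB]
  simp only [Matrix.mul_sub, Matrix.trace_sub]
  have h1 := hP.trace_mul_diagonal_le fun j => (hv j).2
  have h2 := hR.trace_mul_diagonal_nonneg fun j => (hv j).1
  have h3 := abs_le.1 ((abs_trace_mul_le P E).trans
    (mul_le_mul_of_nonneg_right hP.norm_le (norm_nonneg E)))
  have h4 := abs_le.1 ((abs_trace_mul_le R E).trans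
    (mul_le_mul_of_nonneg_right hR.norm_le (norm_nonneg E)))
  linarith [h3.2, h4.1]

/-- The deterministic error bound for the estimated error variances. -/
theorem sum_abs_hatTauSq_sub_le {A : Matrix (Fin p) (Fin p) ℝ}
    {V : Matrix (Fin p) (Fin d) ℝ} (h : IsLeadingEigenvectors A V) (B : Matrix (Fin p) (Fin d) ℝ)
    {v : Fin p → ℝ} (hv : ∀ j, v j ∈ Set.Icc (0 : ℝ) 1)
    (hdiag : ∀ j, A j j = (B * Bᵀ) j j + v j) :
    ∑ j, |hatTauSq A V j - v j|
      ≤ 4 * d + 5 * d * √(∑ j, ∑ k, (A - B * Bᵀ - Matrix.diagonal v) j k ^ 2) := by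
  rw [← frobenius_norm_eq_sqrt]
  have hP := h.isOrthProj
  have h1 := hP.sum_abs_diag_diagonal_le hv
  have h2 := hP.sum_abs_diag_compl_le (E := A - B * Bᵀ - Matrix.diagonal v) (fun j => by
    simp [hdiag j])
  have h3 := h.sum_diag_factor_le B hv
  set P := V * Vᵀ with hPdef
  set E := A - B * Bᵀ - Matrix.diagonal v with hE
  -- Factor part, diagonal part and error part contribute `d + 2d ‖E‖`, `3d` and `3d ‖E‖`.
  have hA : A = B * Bᵀ + Matrix.diagonal v + E := by rw [hE]; abel
  have hterm : ∀ j, |hatTauSq A V j - v j| ≤ |((1 - P) * (B * Bᵀ) * (1 - P) : Matrix (Fin p) (Fin p) ℝ) j j|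
      + |((1 - P) * Matrix.diagonal v * (1 - P)) j j - v j| + |((1 - P) * E * (1 - P)) j j| := by
    intro j
    have : hatTauSq A V j - v j = ((1 - P) * (B * Bᵀ) * (1 - P) : Matrix (Fin p) (Fin p) ℝ) j j
      + (((1 - P) * Matrix.diagonal v * (1 - P)) j j - v j) + ((1 - P) * E * (1 - P)) j j := by
      rw [hatTauSq, ← hPdef, Matrix.transpose_sub, hP.transpose_eq, Matrix.transpose_one]
      conv_lhs => rw [hA]
      rw [Matrix.mul_add, Matrix.mul_add, Matrix.add_mul, Matrix.add_mul, Matrix.add_apply,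
        Matrix.add_apply]
      ring
    rw [this]
    exact abs_add_three _ _ _
  refine (Finset.sum_le_sum fun j _ => hterm j).trans ?_
  rw [Finset.sum_add_distrib, Finset.sum_add_distrib]
  linarith

end LinearAlgebra

/-! ### Empirical frequencies and Gaussian probabilities in the model -/

section Probability

variable {Ω : Type*} [MeasurableSpace Ω] {μ : Measure Ω}

/-- The mean squared error of an empirical frequency. -/
theorem integral_sq_empirical_frequency_le [IsProbabilityMeasure μ] {n : ℕ} {E : Type*} [MeasurableSpace E]
    {X : Fin n → Ω → E} (hX : ∀ i, Measurable (X i)) (hind : iIndepFun X μ) {T : Set E}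
    (hT : MeasurableSet T) {q : ℝ} (hq : ∀ i, μ.real (X i ⁻¹' T) = q) (hn : 0 < n) :
    Integrable (fun ω => ((∑ i, T.indicator (1 : E → ℝ) (X i ω)) / n - q) ^ 2) μ ∧
      ∫ ω, ((∑ i, T.indicator (1 : E → ℝ) (X i ω)) / n - q) ^ 2 ∂μ ≤ 1 / n := by
  have hn' : (0 : ℝ) < n := by exact_mod_cast hn
  have hTm : Measurable (T.indicator (1 : E → ℝ)) := measurable_one.indicator hT
  set ξ : Fin n → Ω → ℝ := fun i ω => T.indicator (1 : E → ℝ) (X i ω) with hξ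
  have hξm : ∀ i, Measurable (ξ i) := fun i => hTm.comp (hX i)
  have hbd : ∀ i ω, ξ i ω ∈ Set.Icc (0 : ℝ) 1 := by
    intro i ω
    by_cases h : X i ω ∈ T <;> simp [hξ, h]
  have hL2 : ∀ i, MemLp (ξ i) 2 μ := fun i =>
    MemLp.of_bound (hξm i).aestronglyMeasurable 1 (Eventually.of_forall fun ω => by
      rw [Real.norm_eq_abs, abs_of_nonneg (hbd i ω).1]; exact (hbd i ω).2)
  have hmean : ∀ i, ∫ ω, ξ i ω ∂μ = q := by
    intro i
    rw [← hq i, ← integral_indicator_one (hX i hT)]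
    rfl
  have hvar : ∀ i, Var[ξ i; μ] ≤ 1 := fun i =>
    (variance_le_sq_of_bounded (a := 0) (b := 1) (Eventually.of_forall (hbd i))
      (hξm i).aemeasurable).trans (by norm_num)
  have hpair : Set.Pairwise (↑(Finset.univ : Finset (Fin n))) fun i j => ξ i ⟂ᵢ[μ] ξ j :=
    fun i _ j _ hij => (hind.indepFun hij).comp hTm hTm
  have hS : MemLp (∑ i, ξ i) 2 μ := memLp_finsetSum' _ fun i _ => hL2 i
  have hF : (fun ω => (∑ i, ξ i ω) / n) = fun ω => (n : ℝ)⁻¹ * (∑ i, ξ i) ω := by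
    ext ω
    rw [Finset.sum_apply, div_eq_inv_mul]
  have hFL2 : MemLp (fun ω => (∑ i, ξ i ω) / n) 2 μ := by
    rw [hF]; exact hS.const_mul _
  have hFmean : ∫ ω, (∑ i, ξ i ω) / n ∂μ = q := by
    rw [integral_div, integral_finsetSum _ fun i _ => (hL2 i).integrable one_le_two]
    simp [hmean, hn'.ne']
  refine ⟨(hFL2.sub (memLp_const q)).integrable_sq, ?_⟩
  have hV := variance_eq_integral (μ := μ) hFL2.aemeasurable
  rw [hFmean] at hV
  rw [← hV, hF, variance_const_mul, IndepFun.variance_sum (fun i _ => hL2 i) hpair]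
  have : ∑ i, Var[ξ i; μ] ≤ n := by
    refine (Finset.sum_le_sum fun i _ => hvar i).trans (by simp)
  calc ((n : ℝ)⁻¹) ^ 2 * ∑ i, Var[ξ i; μ] ≤ ((n : ℝ)⁻¹) ^ 2 * (n : ℝ) := by gcongr
    _ = 1 / (n : ℝ) := by field_simp

theorem real_gt_eq_stdNormalCDF {X : Ω → ℝ} (hX : HasGaussianLaw X μ) (h0 : ∫ ω, X ω ∂μ = 0)
    (h1 : Var[X; μ] = 1) (c : ℝ) : μ.real {ω | c < X ω} = stdNormalCDF (-c) := by
  have hlaw := hX.map_eq_gaussianReal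
  rw [h0, h1, Real.toNNReal_one] at hlaw
  have : (gaussianReal 0 1).real (Set.Ioi c) = stdNormalCDF (-c) := by
    rw [gaussianReal_real_Ioi _ _ one_ne_zero]; simp
  rw [← this, ← hlaw, map_measureReal_apply_of_aemeasurable hX.aemeasurable measurableSet_Ioi]
  rfl

/-- Orthant probabilities of a standardized Gaussian pair. -/
theorem real_gt_and_gt_eq_bivTail [IsProbabilityMeasure μ] {X Y : Ω → ℝ} (hXY : HasGaussianLaw (fun ω => (X ω, Y ω)) μ)
    (hX0 : ∫ ω, X ω ∂μ = 0) (hY0 : ∫ ω, Y ω ∂μ = 0) (hX1 : Var[X; μ] = 1) (hY1 : Var[Y; μ] = 1)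
    {s : ℝ} (hs : s ∈ Set.Ioo (-1 : ℝ) 1) (hcov : cov[X, Y; μ] = s) (c₁ c₂ : ℝ) :
    μ.real {ω | c₁ < X ω ∧ c₂ < Y ω} = bivTail c₁ c₂ s := by
  have hv := one_sub_sq_pos_of_mem hs
  have hXL := hXY.fst.memLp_two
  have hYL := hXY.snd.memLp_two
  have hsXL : MemLp (fun ω => s * X ω) 2 μ := hXL.const_mul s
  -- The regression residual `Y - s X` is uncorrelated with `X` and jointly Gaussian with it, hence
  -- independent, with variance `1 - s²`. Conditioning on `X` then gives `condTail`.
  set W : Ω → ℝ := fun ω => Y ω - s * X ω with hW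
  have hXW : HasGaussianLaw (fun ω => (X ω, W ω)) μ := by
    have := hXY.map_fun ((ContinuousLinearMap.fst ℝ ℝ ℝ).prod
      (ContinuousLinearMap.snd ℝ ℝ ℝ - s • ContinuousLinearMap.fst ℝ ℝ ℝ))
    simpa using this
  have hcovW : cov[X, W; μ] = 0 := by
    rw [hW, covariance_fun_sub_right hXL hYL hsXL, covariance_const_mul_right, hcov,
      covariance_self hXL.aemeasurable, hX1]
    ring
  have hW0 : ∫ ω, W ω ∂μ = 0 := by
    rw [hW, integral_sub (hYL.integrable one_le_two) (hsXL.integrable one_le_two),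
      integral_const_mul, hX0, hY0]
    ring
  have hW1 : Var[W; μ] = 1 - s ^ 2 := by
    rw [← covariance_self hXW.snd.aemeasurable, hW, covariance_fun_sub_fun_sub hYL hsXL hYL hsXL,
      covariance_const_mul_right, covariance_const_mul_left, covariance_const_mul_left,
      covariance_const_mul_right, covariance_comm Y X, hcov,
      covariance_self hXL.aemeasurable, covariance_self hYL.aemeasurable, hX1, hY1]
    ring
  have hlawX := hXW.fst.map_eq_gaussianReal
  rw [hX0, hX1, Real.toNNReal_one] at hlawX
  have hlawW := hXW.snd.map_eq_gaussianReal
  rw [hW0, hW1] at hlawW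
  have hind := hXW.indepFun_of_covariance_eq_zero hcovW
  have hmap := (indepFun_iff_map_prod_eq_prod_map_map hXW.fst.aemeasurable
    hXW.snd.aemeasurable).1 hind
  rw [hlawX, hlawW] at hmap
  have hmeas : MeasurableSet {z : ℝ × ℝ | c₁ < z.1 ∧ c₂ < s * z.1 + z.2} :=
    (measurableSet_lt measurable_const measurable_fst).inter
      (measurableSet_lt measurable_const ((measurable_fst.const_mul s).add measurable_snd))
  have hset : {ω | c₁ < X ω ∧ c₂ < Y ω}
      = (fun ω => (X ω, W ω)) ⁻¹' {z : ℝ × ℝ | c₁ < z.1 ∧ c₂ < s * z.1 + z.2} := by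
    ext ω
    simp [hW]
  rw [hset, ← map_measureReal_apply_of_aemeasurable hXW.aemeasurable hmeas, hmap, measureReal_def,
    Measure.prod_apply hmeas, bivTail_eq_integral hs, ← integral_indicator measurableSet_Ioi,
    ← integral_toReal]
  · congr with x
    by_cases hx : c₁ < x
    · rw [Set.indicator_of_mem (Set.mem_Ioi.2 hx), condTail_eq_real hs]
      have : gaussianReal (s * x) (1 - s ^ 2).toNNReal
          = (gaussianReal 0 (1 - s ^ 2).toNNReal).map (fun y => s * x + y) := by
        rw [gaussianReal_map_const_add, zero_add]
      rw [this, map_measureReal_apply (by fun_prop) measurableSet_Ioi, measureReal_def]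
      congr 2
      ext y
      simp [hx, sub_lt_iff_lt_add']
    · rw [Set.indicator_of_notMem (by simpa using hx)]
      have : Prod.mk x ⁻¹' {z : ℝ × ℝ | c₁ < z.1 ∧ c₂ < s * z.1 + z.2} = ∅ := by
        ext y; simp [hx]
      rw [this]; simp
  · exact (measurable_measure_prodMk_left hmeas).aemeasurable
  · exact Eventually.of_forall fun x => measure_lt_top _ _

namespace IsProbitFactorModel

variable {p d n : ℕ} {B : Matrix (Fin p) (Fin d) ℝ} {τ : Fin p → ℝ}
  {Z : Fin n → Ω → Fin d → ℝ} {ε : Fin n → Ω → Fin p → ℝ}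

omit [MeasurableSpace Ω] in
theorem latent_apply (i : Fin n) (ω : Ω) (j : Fin p) :
    latent B (Z i) (ε i) ω j = ∑ k, B j k * Z i ω k + ε i ω j := rfl

theorem measurable_latent (h : IsProbitFactorModel μ B τ Z ε) (i : Fin n) :
    Measurable (latent B (Z i) (ε i)) := by
  have hZ := h.measurable_factor i
  have hε := h.measurable_noise i
  refine measurable_pi_lambda _ fun j => ?_
  simp only [latent_apply]
  fun_prop

theorem hasGaussianLaw_pair (h : IsProbitFactorModel μ B τ Z ε) (i : Fin n) (j k : Fin p) :
    HasGaussianLaw (fun ω => (latent B (Z i) (ε i) ω j, latent B (Z i) (ε i) ω k)) μ := by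
  have := (h.gaussian i).map_fun ((ContinuousLinearMap.proj (R := ℝ) (φ := fun _ : Fin p => ℝ) j).prod
    (ContinuousLinearMap.proj (R := ℝ) (φ := fun _ : Fin p => ℝ) k))
  simpa using this

theorem covariance_latent [IsProbabilityMeasure μ] (h : IsProbitFactorModel μ B τ Z ε) (i : Fin n) (j l : Fin p) :
    cov[fun ω => latent B (Z i) (ε i) ω j, fun ω => latent B (Z i) (ε i) ω l; μ]
      = (B * Bᵀ) j l + if j = l then τ j ^ 2 else 0 := by
  have hZ : ∀ (j : Fin p) k, MemLp (fun ω => B j k * Z i ω k) 2 μ := fun j k =>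
    (h.memLp_factor i k).const_mul _
  have hS : ∀ j : Fin p, MemLp (fun ω => ∑ k, B j k * Z i ω k) 2 μ := fun j =>
    memLp_finsetSum _ fun k _ => hZ j k
  have hε := h.memLp_noise i
  have hsplit : ∀ j : Fin p, (fun ω => latent B (Z i) (ε i) ω j)
      = (fun ω => ∑ k, B j k * Z i ω k) + fun ω => ε i ω j := fun j => rfl
  have hcross : ∀ j l : Fin p,
      cov[fun ω => ∑ k, B j k * Z i ω k, fun ω => ε i ω l; μ] = 0 := by
    intro j l
    rw [covariance_fun_sum_left (fun k => hZ j k) (hε l)]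
    exact Finset.sum_eq_zero fun k _ => by
      rw [covariance_const_mul_left, h.cov_factor_noise, mul_zero]
  rw [hsplit j, hsplit l, covariance_add_left (hS j) (hε j) ((hS l).add (hε l)),
    covariance_add_right (hS j) (hS l) (hε l), covariance_add_right (hε j) (hS l) (hε l),
    hcross, covariance_comm (fun ω => ε i ω j), hcross, h.cov_noise,
    covariance_fun_sum_fun_sum (fun k => hZ j k) (fun k => hZ l k)]
  simp only [covariance_const_mul_left, covariance_const_mul_right, h.cov_factor]
  simp [Matrix.mul_apply, mul_comm]

theorem diag_add_eq_one [IsProbabilityMeasure μ] (h : IsProbitFactorModel μ B τ Z ε) (i : Fin n) (j : Fin p) :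
    (B * Bᵀ) j j + τ j ^ 2 = 1 := by
  have h1 := h.covariance_latent i j j
  have hm : Measurable fun ω => latent B (Z i) (ε i) ω j :=
    (measurable_pi_apply j).comp (h.measurable_latent i)
  rw [covariance_self hm.aemeasurable,
    h.variance_latent i j, if_pos rfl] at h1
  exact h1.symm

/-- Row `j` of `B` has squared length `1 - τ j ^ 2`, since the latent variances are one; inner
products of rows are then bounded by the arithmetic–geometric mean inequality. -/
theorem abs_factor_le [IsProbabilityMeasure μ] (h : IsProbitFactorModel μ B τ Z ε) (i : Fin n) {t : ℝ} (ht0 : 0 ≤ t)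
    (ht : ∀ j, t ≤ τ j) (j k : Fin p) : |(B * Bᵀ) j k| ≤ 1 - t ^ 2 := by
  have hd : ∀ j, ∑ l, B j l ^ 2 ≤ 1 - t ^ 2 := by
    intro j
    have h1 := h.diag_add_eq_one i j
    have h2 : (B * Bᵀ) j j = ∑ l, B j l ^ 2 := by
      simp [Matrix.mul_apply, sq]
    have h3 := pow_le_pow_left₀ ht0 (ht j) 2
    linarith
  have hab : ∀ x y : ℝ, |x * y| ≤ (x ^ 2 + y ^ 2) / 2 := fun x y => by
    rw [abs_le]; constructor <;> nlinarith [sq_nonneg (x + y), sq_nonneg (x - y)]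
  calc |(B * Bᵀ) j k| ≤ ∑ l, |B j l * B k l| := by
        rw [Matrix.mul_apply]; exact Finset.abs_sum_le_sum_abs _ _
    _ ≤ ∑ l, (B j l ^ 2 + B k l ^ 2) / 2 := Finset.sum_le_sum fun l _ => hab _ _
    _ = (∑ l, B j l ^ 2 + ∑ l, B k l ^ 2) / 2 := by
        rw [← Finset.sum_div, Finset.sum_add_distrib]
    _ ≤ 1 - t ^ 2 := by linarith [hd j, hd k]

theorem real_latent_gt (h : IsProbitFactorModel μ B τ Z ε) (i : Fin n) (j : Fin p) (c : ℝ) :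
    μ.real {ω | c < latent B (Z i) (ε i) ω j} = stdNormalCDF (-c) :=
  real_gt_eq_stdNormalCDF (h.hasGaussianLaw_pair i j j).fst (h.mean_latent i j)
    (h.variance_latent i j) c

theorem real_latent_gt_and_gt [IsProbabilityMeasure μ] (h : IsProbitFactorModel μ B τ Z ε) (i : Fin n) {j k : Fin p}
    (hjk : j ≠ k) (hs : (B * Bᵀ) j k ∈ Set.Ioo (-1 : ℝ) 1) (c₁ c₂ : ℝ) :
    μ.real {ω | c₁ < latent B (Z i) (ε i) ω j ∧ c₂ < latent B (Z i) (ε i) ω k}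
      = bivTail c₁ c₂ ((B * Bᵀ) j k) :=
  real_gt_and_gt_eq_bivTail (h.hasGaussianLaw_pair i j k) (h.mean_latent i j) (h.mean_latent i k)
    (h.variance_latent i j) (h.variance_latent i k) hs
    (by rw [h.covariance_latent i j k, if_neg hjk, add_zero]) c₁ c₂

end IsProbitFactorModel

end Probability

/-! ### Mean-square consistency of the estimated covariance matrix -/

section Consistency

/-- A solution lies in `(-1, 1)`, and the default value used otherwise is one fixed real number,
whatever the arguments. -/
theorem exists_abs_bivTailInv_le :
    ∃ M : ℝ, 0 ≤ M ∧ ∀ c₁ c₂ P, |bivTailInv c₁ c₂ P| ≤ M := by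
  refine ⟨max 1 |Classical.choice (inferInstance : Nonempty ℝ)|,
    zero_le_one.trans (le_max_left _ _), fun c₁ c₂ P => ?_⟩
  by_cases h : ∃ s ∈ Set.Ioo (-1 : ℝ) 1, bivTail c₁ c₂ s = P
  · have := Function.invFunOn_mem h
    exact (abs_le.2 ⟨this.1.le, this.2.le⟩).trans (le_max_left _ _)
  · rw [bivTailInv, Function.invFunOn_neg h]
    exact le_max_right _ _

variable {p d n : ℕ}

/-- If the frequencies are `δ`-close to the truth, the error is below `η`. Otherwise one of them is
off by at least `δ`, so their summed squared error over `δ²` is at least `1` and pays for the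
trivial bound `(M + 1)²`. -/
theorem sq_hatSigma_sub_le {Y : Fin n → Fin p → ℕ} {c : Fin p → ℝ} {j k : Fin p} (hjk : j ≠ k)
    {s M η δ : ℝ} (hs : |s| ≤ 1) (hM : ∀ c₁ c₂ P, |bivTailInv c₁ c₂ P| ≤ M) (hδ : 0 < δ)
    (hclose : ∀ u, dist u (cellProbs (c j, c k, s)) < δ → |corrEst u - s| < η) :
    (hatSigma Y j k - s) ^ 2 ≤ η ^ 2 + (M + 1) ^ 2 / δ ^ 2 *
      ((hatP Y j - stdNormalCDF (-c j)) ^ 2 + (hatP Y k - stdNormalCDF (-c k)) ^ 2 +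
        (hatP₂ Y j k - bivTail (c j) (c k) s) ^ 2) := by
  have hsig : hatSigma Y j k = corrEst (hatP Y j, hatP Y k, hatP₂ Y j k) := by
    simp [hatSigma, hjk, corrEst, hatC]
  rw [hsig]
  set u : ℝ × ℝ × ℝ := (hatP Y j, hatP Y k, hatP₂ Y j k) with hu
  set S := (hatP Y j - stdNormalCDF (-c j)) ^ 2 + (hatP Y k - stdNormalCDF (-c k)) ^ 2 +
    (hatP₂ Y j k - bivTail (c j) (c k) s) ^ 2 with hS
  have hS0 : 0 ≤ S := by positivity
  by_cases h : dist u (cellProbs (c j, c k, s)) < δ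
  · have h1 := sq_le_sq' (abs_lt.1 (hclose u h)).1.le (abs_lt.1 (hclose u h)).2.le
    have h2 : 0 ≤ (M + 1) ^ 2 / δ ^ 2 * S := by positivity
    linarith
  · have hsq : δ ^ 2 ≤ S := by
      rw [not_lt, Prod.dist_eq, Prod.dist_eq, le_max_iff, le_max_iff, Real.dist_eq, Real.dist_eq,
        Real.dist_eq] at h
      simp only [hu, cellProbs] at h
      have h1 := sq_nonneg (hatP Y j - stdNormalCDF (-c j))
      have h2 := sq_nonneg (hatP Y k - stdNormalCDF (-c k))
      have h3 := sq_nonneg (hatP₂ Y j k - bivTail (c j) (c k) s)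
      rcases h with h | h | h
      all_goals
        have h4 := pow_le_pow_left₀ hδ.le h 2
        rw [sq_abs] at h4
        linarith
    have habs : |corrEst u - s| ≤ M + 1 :=
      (abs_sub _ _).trans (add_le_add (hM _ _ _) hs)
    have h1 := sq_le_sq' (abs_le.1 habs).1 (abs_le.1 habs).2
    have h2 : (M + 1) ^ 2 ≤ (M + 1) ^ 2 / δ ^ 2 * S := by
      rw [div_mul_eq_mul_div, le_div_iff₀ (by positivity)]
      exact mul_le_mul_of_nonneg_left hsq (sq_nonneg _)
    nlinarith [sq_nonneg η]

/-- The average squared error of the empirical frequencies of order one and two. -/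
noncomputable def freqError (Y : Fin n → Fin p → ℕ) (P₁ : Fin p → ℝ) (P₂ : Fin p → Fin p → ℝ) :
    ℝ :=
  (∑ j, ∑ k, ((hatP Y j - P₁ j) ^ 2 + (hatP Y k - P₁ k) ^ 2 + (hatP₂ Y j k - P₂ j k) ^ 2)) /
    (p : ℝ) ^ 2

theorem freqError_nonneg (Y : Fin n → Fin p → ℕ) (P₁ : Fin p → ℝ) (P₂ : Fin p → Fin p → ℝ) :
    0 ≤ freqError Y P₁ P₂ := by
  unfold freqError; positivity

theorem mean_abs_hatTauSq_sub_le (hp : 0 < p) {Y : Fin n → Fin p → ℕ}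
    {V : Matrix (Fin p) (Fin d) ℝ} (hV : IsLeadingEigenvectors (hatSigma Y) V)
    {B : Matrix (Fin p) (Fin d) ℝ} {τ c : Fin p → ℝ} {P₂ : Fin p → Fin p → ℝ} {M η δ : ℝ}
    (hB1 : ∀ j, (B * Bᵀ) j j + τ j ^ 2 = 1) (hBs : ∀ j k, |(B * Bᵀ) j k| ≤ 1)
    (hP₂ : ∀ j k, j ≠ k → P₂ j k = bivTail (c j) (c k) ((B * Bᵀ) j k))
    (hM : ∀ c₁ c₂ P, |bivTailInv c₁ c₂ P| ≤ M) (hδ : 0 < δ)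
    (hclose : ∀ j k, ∀ u, dist u (cellProbs (c j, c k, (B * Bᵀ) j k)) < δ →
      |corrEst u - (B * Bᵀ) j k| < η) :
    (p : ℝ)⁻¹ * ∑ j, |hatTauSq (hatSigma Y) V j - τ j ^ 2|
      ≤ 4 * d / p + 5 * d * √(η ^ 2 + (M + 1) ^ 2 / δ ^ 2 *
        freqError Y (fun j => stdNormalCDF (-c j)) P₂) := by
  have hp' : (0 : ℝ) < p := by exact_mod_cast hp
  have hτ : ∀ j, τ j ^ 2 ∈ Set.Icc (0 : ℝ) 1 := fun j => ⟨sq_nonneg _, by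
    have : 0 ≤ (B * Bᵀ) j j := by
      rw [Matrix.mul_apply]
      exact Finset.sum_nonneg fun k _ => by rw [Matrix.transpose_apply]; exact mul_self_nonneg _
    linarith [hB1 j]⟩
  have hdiag : ∀ j, hatSigma Y j j = (B * Bᵀ) j j + τ j ^ 2 := fun j => by
    rw [hB1 j]; simp [hatSigma]
  have hmain := sum_abs_hatTauSq_sub_le hV B hτ hdiag
  set K := (M + 1) ^ 2 / δ ^ 2 with hK
  have hK0 : 0 ≤ K := by positivity
  set W := freqError Y (fun j => stdNormalCDF (-c j)) P₂ with hW
  have hsum : ∑ j, ∑ k, (hatSigma Y - B * Bᵀ - Matrix.diagonal fun j => τ j ^ 2) j k ^ 2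
      ≤ (p : ℝ) ^ 2 * (η ^ 2 + K * W) := by
    have hterm : ∀ j k, (hatSigma Y - B * Bᵀ - Matrix.diagonal fun j => τ j ^ 2) j k ^ 2
        ≤ η ^ 2 + K * ((hatP Y j - stdNormalCDF (-c j)) ^ 2 +
          (hatP Y k - stdNormalCDF (-c k)) ^ 2 + (hatP₂ Y j k - P₂ j k) ^ 2) := by
      intro j k
      by_cases hjk : j = k
      · subst hjk
        have : (hatSigma Y - B * Bᵀ - Matrix.diagonal fun j => τ j ^ 2) j j = 0 := by
          simp [hdiag j]
        rw [this, zero_pow two_ne_zero]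
        positivity
      · rw [Matrix.sub_apply, Matrix.sub_apply, Matrix.diagonal_apply_ne _ hjk, sub_zero,
          hP₂ j k hjk]
        exact sq_hatSigma_sub_le hjk (hBs j k) hM hδ (hclose j k)
    refine (Finset.sum_le_sum fun j _ => Finset.sum_le_sum fun k _ => hterm j k).trans (le_of_eq ?_)
    simp only [Finset.sum_add_distrib (f := fun _ => η ^ 2), Finset.sum_const, Finset.card_univ,
      Fintype.card_fin, nsmul_eq_mul, ← Finset.mul_sum]
    rw [hW, freqError, Finset.sum_add_distrib, ← Finset.mul_sum, Finset.sum_const,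
      Finset.card_univ, Fintype.card_fin, nsmul_eq_mul]
    field_simp
    rw [Finset.mul_sum]
  have hsqrt : √(∑ j, ∑ k, (hatSigma Y - B * Bᵀ - Matrix.diagonal fun j => τ j ^ 2) j k ^ 2)
      ≤ p * √(η ^ 2 + K * W) := by
    refine (Real.sqrt_le_sqrt hsum).trans (le_of_eq ?_)
    rw [Real.sqrt_mul (by positivity), Real.sqrt_sq hp'.le]
  calc (p : ℝ)⁻¹ * ∑ j, |hatTauSq (hatSigma Y) V j - τ j ^ 2|
      ≤ (p : ℝ)⁻¹ * (4 * d + 5 * d * (p * √(η ^ 2 + K * W))) := by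
        gcongr
        exact hmain.trans (by gcongr)
    _ = 4 * d / p + 5 * d * √(η ^ 2 + K * W) := by field_simp

variable {Ω : Type*} [MeasurableSpace Ω] {μ : Measure Ω} [IsProbabilityMeasure μ]

/-- The expectation of the average squared error of the empirical frequencies. -/
theorem IsProbitFactorModel.integral_freqError_le {B : Matrix (Fin p) (Fin d) ℝ} {τ : Fin p → ℝ}
    {Z : Fin n → Ω → Fin d → ℝ} {ε : Fin n → Ω → Fin p → ℝ} (h : IsProbitFactorModel μ B τ Z ε)
    (hn : 0 < n) (hp : 0 < p) {c : Fin p → ℝ} {P₁ : Fin p → ℝ} {P₂ : Fin p → Fin p → ℝ}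
    (hP₁ : ∀ i j, μ.real {ω | c j < latent B (Z i) (ε i) ω j} = P₁ j)
    (hP₂ : ∀ i j k, μ.real {ω | c j < latent B (Z i) (ε i) ω j ∧
      c k < latent B (Z i) (ε i) ω k} = P₂ j k) :
    Integrable (fun ω => freqError (fun i => binaryObs c (latent B (Z i) (ε i)) ω) P₁ P₂) μ ∧
      ∫ ω, freqError (fun i => binaryObs c (latent B (Z i) (ε i)) ω) P₁ P₂ ∂μ ≤ 3 / n := by
  classical
  have hp' : (0 : ℝ) < p := by exact_mod_cast hp
  have hT₁ : ∀ j, MeasurableSet {x : Fin p → ℝ | c j < x j} := fun j =>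
    measurableSet_lt measurable_const (measurable_pi_apply j)
  have h1 : ∀ j, Integrable (fun ω =>
        (hatP (fun i => binaryObs c (latent B (Z i) (ε i)) ω) j - P₁ j) ^ 2) μ ∧
      ∫ ω, (hatP (fun i => binaryObs c (latent B (Z i) (ε i)) ω) j - P₁ j) ^ 2 ∂μ ≤ 1 / n := by
    intro j
    have key := integral_sq_empirical_frequency_le h.measurable_latent h.indep (hT₁ j)
      (fun i => hP₁ i j) hn
    have heq : ∀ ω, hatP (fun i => binaryObs c (latent B (Z i) (ε i)) ω) j
        = (∑ i, Set.indicator {x : Fin p → ℝ | c j < x j} (1 : (Fin p → ℝ) → ℝ)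
          (latent B (Z i) (ε i) ω)) / n := by
      intro ω
      simp [hatP, binaryObs, Set.indicator_apply]
    simpa only [heq] using key
  have h2 : ∀ j k, Integrable (fun ω =>
        (hatP₂ (fun i => binaryObs c (latent B (Z i) (ε i)) ω) j k - P₂ j k) ^ 2) μ ∧
      ∫ ω, (hatP₂ (fun i => binaryObs c (latent B (Z i) (ε i)) ω) j k - P₂ j k) ^ 2 ∂μ
        ≤ 1 / n := by
    intro j k
    have key := integral_sq_empirical_frequency_le h.measurable_latent h.indep
      ((hT₁ j).inter (hT₁ k)) (fun i => hP₂ i j k) hn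
    have heq : ∀ ω, hatP₂ (fun i => binaryObs c (latent B (Z i) (ε i)) ω) j k
        = (∑ i, Set.indicator ({x : Fin p → ℝ | c j < x j} ∩ {x | c k < x k})
          (1 : (Fin p → ℝ) → ℝ) (latent B (Z i) (ε i) ω)) / n := by
      intro ω
      simp [hatP₂, binaryObs, Set.indicator_apply]
    simpa only [heq] using key
  have hint : ∀ j k, Integrable (fun ω =>
      (hatP (fun i => binaryObs c (latent B (Z i) (ε i)) ω) j - P₁ j) ^ 2 +
      (hatP (fun i => binaryObs c (latent B (Z i) (ε i)) ω) k - P₁ k) ^ 2 +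
      (hatP₂ (fun i => binaryObs c (latent B (Z i) (ε i)) ω) j k - P₂ j k) ^ 2) μ := fun j k =>
    ((h1 j).1.add (h1 k).1).add (h2 j k).1
  refine ⟨(integrable_finsetSum _ fun j _ => integrable_finsetSum _ fun k _ =>
    hint j k).div_const _, ?_⟩
  simp only [freqError]
  rw [integral_div, integral_finsetSum _ fun j _ => integrable_finsetSum _ fun k _ => hint j k,
    div_le_iff₀ (by positivity)]
  have hjk : ∀ j k, ∫ ω, ((hatP (fun i => binaryObs c (latent B (Z i) (ε i)) ω) j - P₁ j) ^ 2 +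
      (hatP (fun i => binaryObs c (latent B (Z i) (ε i)) ω) k - P₁ k) ^ 2 +
      (hatP₂ (fun i => binaryObs c (latent B (Z i) (ε i)) ω) j k - P₂ j k) ^ 2) ∂μ
        ≤ 3 / n := by
    intro j k
    rw [integral_add (by exact (h1 j).1.add (h1 k).1) (h2 j k).1, integral_add (h1 j).1 (h1 k).1]
    have : (3 : ℝ) / n = 1 / n + 1 / n + 1 / n := by ring
    rw [this]
    exact add_le_add (add_le_add (h1 j).2 (h1 k).2) (h2 j k).2
  calc ∑ j, ∫ ω, ∑ k, ((hatP (fun i => binaryObs c (latent B (Z i) (ε i)) ω) j - P₁ j) ^ 2 +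
      (hatP (fun i => binaryObs c (latent B (Z i) (ε i)) ω) k - P₁ k) ^ 2 +
      (hatP₂ (fun i => binaryObs c (latent B (Z i) (ε i)) ω) j k - P₂ j k) ^ 2) ∂μ
      ≤ ∑ _j : Fin p, ∑ _k : Fin p, (3 : ℝ) / n := Finset.sum_le_sum fun j _ => by
        rw [integral_finsetSum _ fun k _ => hint j k]
        exact Finset.sum_le_sum fun k _ => hjk j k
    _ = 3 / n * (p : ℝ) ^ 2 := by
        simp only [Finset.sum_const, Finset.card_univ, Fintype.card_fin, nsmul_eq_mul]
        ring

end Consistency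

/-! ### Convergence in probability -/

theorem theorem3 {Ω : Type*} [MeasurableSpace Ω] (μ : Measure Ω) [IsProbabilityMeasure μ]
    (d : ℕ) (p : ℕ → ℕ)
    (B : ∀ n, Matrix (Fin (p n)) (Fin d) ℝ) (τ c : ∀ n, Fin (p n) → ℝ)
    (Z : ∀ n, Fin n → Ω → Fin d → ℝ) (ε : ∀ n, Fin n → Ω → Fin (p n) → ℝ)
    (hmodel : ∀ n, IsProbitFactorModel μ (B n) (τ n) (Z n) (ε n))
    (Y : ∀ n, Fin n → Ω → Fin (p n) → ℕ)
    (hY : ∀ n i, Y n i = binaryObs (c n) (latent (B n) (Z n i) (ε n i)))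
    -- univariate probabilities
    (hC1 : ∃ Pmin Pmax : ℝ, 0 < Pmin ∧ Pmin ≤ Pmax ∧ Pmax < 1 ∧
      ∀ n i j, μ.real {ω | Y n i ω j = 1} ∈ Set.Icc Pmin Pmax)
    -- bivariate probabilities
    (hC2 : ∃ Pmin Pmax : ℝ, 0 < Pmin ∧ Pmin ≤ Pmax ∧ Pmax < 1 ∧
      ∀ n i j k, μ.real {ω | Y n i ω j = 1 ∧ Y n i ω k = 1} ∈ Set.Icc Pmin Pmax)
    -- error standard deviations
    (hC3 : ∃ τmin τmax : ℝ, 0 < τmin ∧ τmin ≤ τmax ∧ τmax < 1 ∧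
      ∀ n j, τ n j ∈ Set.Icc τmin τmax)
    -- the dimension diverges, but slowly
    (hp : Tendsto p atTop atTop)
    (hC4 : ∃ ρ ξ : ℝ, 0 < ρ ∧ 0 < ξ ∧ ξ < 1 / 2 ∧ ∀ n : ℕ, 1 ≤ n → (p n : ℝ) ≤ ρ * (n : ℝ) ^ ξ)
    -- any choice of the leading eigenvectors of the estimated covariance matrix
    (V : ∀ n, Ω → Matrix (Fin (p n)) (Fin d) ℝ)
    (hV : ∀ n, d ≤ p n → ∀ ω, IsLeadingEigenvectors (hatSigma fun i => Y n i ω) (V n ω)) :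
    TendstoInMeasure μ
      (fun n ω => (p n : ℝ)⁻¹ *
        ∑ j, |hatTauSq (hatSigma fun i => Y n i ω) (V n ω) j - τ n j ^ 2|)
      atTop (fun _ => 0) := by
  obtain ⟨P₁min, P₁max, hP₁0, -, hP₁1, hC1⟩ := hC1
  obtain ⟨τmin, τmax, hτ0, -, hτ1, hC3⟩ := hC3
  obtain rfl : Y = fun n i => binaryObs (c n) (latent (B n) (Z n i) (ε n i)) :=
    funext fun n => funext fun i => hY n i
  clear hY
  have hYone : ∀ n i ω j, binaryObs (c n) (latent (B n) (Z n i) (ε n i)) ω j = 1 ↔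
      c n j < latent (B n) (Z n i) (ε n i) ω j := fun n i ω j => by simp [binaryObs]
  obtain ⟨M, hM0, hM⟩ := exists_abs_bivTailInv_le
  set r : ℝ := 1 - τmin ^ 2 with hr
  have hr1 : r < 1 := by rw [hr]; have := pow_pos hτ0 2; linarith
  -- An empty sample puts no constraint on `B`, so an observation is needed to read off the unit
  -- variances.
  have hBr : ∀ n, 0 < n → ∀ j k, |(B n * (B n)ᵀ) j k| ≤ r := fun n hn j k =>
    (hmodel n).abs_factor_le ⟨0, hn⟩ hτ0.le (fun j => (hC3 n j).1) j k
  -- the thresholds are bounded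
  obtain ⟨xa, hxa⟩ : ∃ x, stdNormalCDF x < P₁min :=
    ((tendsto_order.1 (tendsto_cdf_atBot (gaussianReal 0 1))).2 _ hP₁0).exists
  obtain ⟨xb, hxb⟩ : ∃ x, P₁max < stdNormalCDF x :=
    ((tendsto_order.1 (tendsto_cdf_atTop (gaussianReal 0 1))).1 _ hP₁1).exists
  have hc : ∀ n, 0 < n → ∀ j, c n j ∈ Set.Icc (-xb) (-xa) := by
    intro n hn j
    have h1 := hC1 n ⟨0, hn⟩ j
    simp only [hYone] at h1
    rw [(hmodel n).real_latent_gt] at h1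
    have h2 := strictMono_stdNormalCDF.lt_iff_lt.1 (hxa.trans_le h1.1)
    have h3 := strictMono_stdNormalCDF.lt_iff_lt.1 (h1.2.trans_lt hxb)
    exact ⟨by linarith, by linarith⟩
  rw [tendstoInMeasure_iff_dist]
  intro κ hκ
  -- Off the event `θ ≤ W`, the choice `θ = η² / K` below keeps the square root at most `2η`. The
  -- error is then at most `4d/p + 10 d η`, less than `κ/2 + κ/4`.
  set η : ℝ := κ / (40 * (d + 1)) with hη
  have hη0 : 0 < η := by positivity
  obtain ⟨δ, hδ, hclose⟩ := corrEst_uniformly_close (-xb) (-xa) r hr1 hη0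
  set K := (M + 1) ^ 2 / δ ^ 2 with hK
  have hK0 : 0 < K := by positivity
  set θ := η ^ 2 / K with hθ
  have hθ0 : 0 < θ := by positivity
  have hlim : Tendsto (fun n : ℕ => ENNReal.ofReal (3 / n / θ)) atTop (𝓝 0) := by
    have : Tendsto (fun n : ℕ => (3 : ℝ) / n / θ) atTop (𝓝 (0 / θ)) :=
      (tendsto_const_div_atTop_nhds_zero_nat 3).div_const θ
    rw [zero_div] at this
    simpa using ENNReal.tendsto_ofReal this
  have hpR : Tendsto (fun n => 4 * (d : ℝ) / p n) atTop (𝓝 0) :=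
    tendsto_const_nhds.div_atTop (tendsto_natCast_atTop_atTop.comp hp)
  refine tendsto_of_tendsto_of_tendsto_of_le_of_le' tendsto_const_nhds hlim
    (Eventually.of_forall fun _ => zero_le) ?_
  filter_upwards [eventually_gt_atTop 0, hp.eventually_ge_atTop (max d 1),
    hpR.eventually_lt_const (half_pos hκ)] with n hn hpn hpκ
  have hdp : d ≤ p n := (le_max_left _ _).trans hpn
  have hp0 : 0 < p n := (le_max_right d 1).trans hpn
  set P₂ : Fin (p n) → Fin (p n) → ℝ := fun j k =>
    μ.real {ω | c n j < latent (B n) (Z n ⟨0, hn⟩) (ε n ⟨0, hn⟩) ω j ∧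
      c n k < latent (B n) (Z n ⟨0, hn⟩) (ε n ⟨0, hn⟩) ω k} with hP₂
  have hsmem : ∀ j k, (B n * (B n)ᵀ) j k ∈ Set.Ioo (-1 : ℝ) 1 := fun j k =>
    abs_lt.1 ((hBr n hn j k).trans_lt hr1)
  have hP₂b : ∀ j k, j ≠ k → P₂ j k = bivTail (c n j) (c n k) ((B n * (B n)ᵀ) j k) :=
    fun j k hjk => (hmodel n).real_latent_gt_and_gt _ hjk (hsmem j k) _ _
  have hP₂i : ∀ i j k, μ.real {ω | c n j < latent (B n) (Z n i) (ε n i) ω j ∧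
      c n k < latent (B n) (Z n i) (ε n i) ω k} = P₂ j k := by
    intro i j k
    -- On the diagonal the joint probability is the univariate one: the latent correlation is `1`
    -- there, not `(B Bᵀ) j j`, so the `bivTail` formula does not apply.
    by_cases hjk : j = k
    · subst hjk
      simp only [hP₂, and_self]
      rw [(hmodel n).real_latent_gt, (hmodel n).real_latent_gt]
    · rw [hP₂b j k hjk, (hmodel n).real_latent_gt_and_gt i hjk (hsmem j k)]
  obtain ⟨hWint, hWle⟩ := (hmodel n).integral_freqError_le hn hp0 (c := c n)
    (P₁ := fun j => stdNormalCDF (-c n j)) (P₂ := P₂)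
    (fun i j => (hmodel n).real_latent_gt i j _) hP₂i
  set W : Ω → ℝ := fun ω => freqError (fun i => binaryObs (c n) (latent (B n) (Z n i) (ε n i)) ω)
    (fun j => stdNormalCDF (-c n j)) P₂ with hW
  have hW0 : ∀ ω, 0 ≤ W ω := fun ω => freqError_nonneg _ _ _
  -- The eigenvectors `V n` need not depend measurably on `ω`, so the event is covered by one
  -- defined through the integrable `W`, to which Markov's inequality applies.
  have hsub : {ω | κ ≤ dist ((p n : ℝ)⁻¹ * ∑ j, |hatTauSq (hatSigma fun i =>
      binaryObs (c n) (latent (B n) (Z n i) (ε n i)) ω) (V n ω) j - τ n j ^ 2|) 0}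
      ⊆ {ω | θ ≤ W ω} := by
    intro ω hω
    by_contra hlt
    simp only [Set.mem_ofPred_eq, not_le] at hω hlt
    rw [Real.dist_eq, sub_zero, abs_of_nonneg (by positivity)] at hω
    have hbound := mean_abs_hatTauSq_sub_le hp0 (hV n hdp ω)
      ((hmodel n).diag_add_eq_one ⟨0, hn⟩) (fun j k => (hBr n hn j k).trans hr1.le) hP₂b hM hδ
      (fun j k => hclose _ (hc n hn j) _ (hc n hn k) _ (abs_le.1 (hBr n hn j k)))
    have hKW : K * W ω ≤ η ^ 2 := by
      rw [mul_comm]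
      exact ((lt_div_iff₀ hK0).1 hlt).le
    have hsq : √(η ^ 2 + K * W ω) ≤ 2 * η := by
      rw [Real.sqrt_le_left (by positivity)]
      nlinarith
    have h1 : 5 * (d : ℝ) * √(η ^ 2 + K * W ω) ≤ 5 * d * (2 * η) := by gcongr
    have h2 : 5 * (d : ℝ) * (2 * η) ≤ κ / 4 := by
      rw [hη]
      have hd : (0 : ℝ) ≤ d := Nat.cast_nonneg d
      rw [show 5 * (d : ℝ) * (2 * (κ / (40 * (d + 1)))) = κ / 4 * (d / (d + 1)) by
        field_simp; ring]
      exact mul_le_of_le_one_right (by positivity) (by rw [div_le_one (by positivity)]; linarith)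
    linarith
  refine (measure_mono hsub).trans ?_
  have hmarkov := mul_meas_ge_le_integral_of_nonneg (Eventually.of_forall hW0) hWint θ
  rw [← ofReal_measureReal]
  refine ENNReal.ofReal_le_ofReal ?_
  rw [le_div_iff₀ hθ0, mul_comm]
  exact hmarkov.trans hWle
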